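/- All algebras are unital and over $\mathbb{C}$. A Hopf $*$-algebra is a Hopf algebra $A$ with a conjugate linear antimultiplicative involution $*$ such that $\Delta(a^*)=\Delta(a)^{*\otimes *}$. A compact quantum group algebra (CQGA) is a Hopf $*$-algebra $A$ which is cosemisimple, i.e. there is a unique linear functional $\mathbf{h}:A\to\mathbb{C}$ (the Haar functional) with $\mathbf{h}(1)=1$ and $(\mathrm{id}\otimes\mathbf{h})\Delta(a)=\mathbf{h}(a)1=(\mathbf{h}\otimes\mathrm{id})\Delta(a)$, and for which $\mathbf{h}(a^*a)>0$ for all $a\neq0$. Let $\pi:A\to H$ be a surjective Hopf $*$-algebra map between CQGAs, and let $B=A^{\mathrm{co}(H)}=\{a\in A : (\mathrm{id}\otimes\pi)\Delta(a)=a\otimes 1\}$, with the left $A$-coaction given by the restriction of $\Delta$. Let $\Omega^\bullet=\bigoplus_{k\ge0}\Omega^k$ be a differential $*$-calculus over $B$: a differential graded algebra $(\Omega^\bullet,\mathrm{d})$ with $\Omega^0=B$, generated as an algebra by $B$ and $\mathrm{d}B$, with a conjugate linear involution $*$ extending that of $B$ such that $\mathrm{d}(\omega^*)=(\mathrm{d}\omega)^*$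 and $(\omega\wedge\nu)^*=(-1)^{kl}\nu^*\wedge\omega^*$ for $\omega\in\Omega^k$, $\nu\in\Omega^l$. Assume that it is left $A$-covariant (the coaction of $B$ extends to a left $A$-comodule algebra structure $\Delta_L$ on $\Omega^\bullet$ for which $\mathrm{d}$ is a comodule map), that $\Omega^\bullet$ is finitely generated as a left $B$-module, and that $\Omega^\bullet B^+=B^+\Omega^\bullet$, where $B^+=B\cap\ker\varepsilon$. A complex structure is an $\mathbb{N}_0^2$-algebra grading $\Omega^\bullet=\bigoplus\Omega^{(a,b)}$ with $\Omega^k=\bigoplus_{a+b=k}\Omega^{(a,b)}$, $(\Omega^{(a,b)})^*=\Omega^{(b,a)}$ and $\mathrm{d}\Omega^{(a,b)}\subseteq\Omega^{(a+1,b)}\oplus\Omega^{(a,b+1)}$; $\partial$ and $\bar\partial$ are the components of $\mathrm{d}$ of bidegree $(1,0)$ and $(0,1)$. A Hermitian structure $(\Omega^{(\bullet,\bullet)},\sigma)$, for a calculus of total degree $2n$ (that is, $\Omega^{2n}\ne0$ and $\Omega^k=0$ for $k>2n$), is a complex structure together with a central form $\sigma\in\Omega^{(1,1)}$ with $\sigma^*=\sigma$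 such that, for $L_\sigma(\omega)=\sigma\wedge\omega$, the maps $L_\sigma^{n-k}:\Omega^k\to\Omega^{2n-k}$, $0\le k<n$, are isomorphisms. Its Hodge map $\ast_\sigma:\Omega^\bullet\to\Omega^\bullet$ is the unique linear map with $$\ast_\sigma(L_\sigma^j\omega)=(-1)^{\frac{k(k+1)}2}\mathbf{i}^{a-b}\frac{j!}{(n-j-k)!}L_\sigma^{n-j-k}\omega$$ for all $\omega\in\Omega^{(a,b)}$ with $k=a+b\le n$ and $L_\sigma^{n-k+1}\omega=0$, and all $0\le j\le n-k$. Its metric $g_\sigma:\Omega^\bullet\times\Omega^\bullet\to B$ is given by $g_\sigma(\omega,\nu)=\ast_\sigma(\omega\wedge\ast_\sigma(\nu^*))$ for $\omega,\nu\in\Omega^k$ and $g_\sigma(\Omega^k,\Omega^l)=0$ for $k\neq l$. Suppose that $\mathbf{H}=(B,\Omega^\bullet,\Omega^{(\bullet,\bullet)},\sigma)$ is a CQH-Hermitian space, i.e. that moreover: every $\Omega^{(a,b)}$ is a left $A$-subcomodule and $\Delta_L(\sigma)=1\otimes\sigma$ (covariance); $\mathbf{h}(\ast_\sigma(\mathrm{d}\omega))=0$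 for all $\omega\in\Omega^{2n-1}$ (closed integral); and, for all $\omega\ne0$, $g_\sigma(\omega,\omega)$ is a nonzero element of the form $\sum_i b_i^*b_i$ with $b_i\in B$ (positivity). Then $\langle\omega,\nu\rangle_\sigma=\mathbf{h}(g_\sigma(\omega,\nu))$ is an inner product on $\Omega^\bullet$; let $L^2(\Omega^\bullet)$ be the Hilbert space completion. **Statement.** The maps $\partial,\bar\partial,\mathrm{d}:\Omega^\bullet\to\Omega^\bullet$ are adjointable with respect to $\langle\cdot,\cdot\rangle_\sigma$, with adjoints $\partial^\dagger,\bar\partial^\dagger,\mathrm{d}^\dagger:\Omega^\bullet\to\Omega^\bullet$, and the Dirac operators $$D_\partial=\partial+\partial^\dagger,\qquad D_{\bar\partial}=\bar\partial+\bar\partial^\dagger,\qquad D_{\mathrm{d}}=\mathrm{d}+\mathrm{d}^\dagger$$ and the Laplace operators $\Delta_\partial=D_\partial^2$, $\Delta_{\bar\partial}=D_{\bar\partial}^2$, $\Delta_{\mathrm{d}}=D_{\mathrm{d}}^2$, regarded as unbounded operators on $L^2(\Omega^\bullet)$ with domain $\Omega^\bullet$, are diagonalisable (there is an orthonormal basis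 of $L^2(\Omega^\bullet)$ consisting of eigenvectors that lie in the domain) and essentially self-adjoint (closable, with self-adjoint closure). -/

import Mathlib

open scoped TensorProduct ComplexOrder InnerProductSpace Nat

noncomputable section

namespace CQH

/-! ### Compact quantum group algebras -/

/-- `h` is a normalised bi-invariant linear functional on the Hopf algebra `A`:
`h(1) = 1`, `(id ⊗ h) Δ(a) = h(a) 1` and `(h ⊗ id) Δ(a) = h(a) 1`. -/
structure IsHaarFunctional {A : Type*} [Ring A] [HopfAlgebra ℂ A] (h : A →ₗ[ℂ] ℂ) : Prop where
  map_one : h 1 = 1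
  right_inv : ∀ a : A,
    TensorProduct.rid ℂ A (h.lTensor A (Coalgebra.comul (R := ℂ) a)) = h a • (1 : A)
  left_inv : ∀ a : A,
    TensorProduct.lid ℂ A (h.rTensor A (Coalgebra.comul (R := ℂ) a)) = h a • (1 : A)

/-- A compact quantum group algebra: a Hopf `*`-algebra over `ℂ` (the coproduct is a `*`-map for
the `*`-structure `(a ⊗ b)* = a* ⊗ b*`) which is cosemisimple (it has a unique Haar functional)
and whose Haar functional is positive. -/
structure IsCQGA (A : Type*) [Ring A] [HopfAlgebra ℂ A] [StarRing A] [StarModule ℂ A] :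
    Prop where
  comul_star : ∀ a : A, Coalgebra.comul (R := ℂ) (star a) = star (Coalgebra.comul (R := ℂ) a)
  existsUnique_haar : ∃! h : A →ₗ[ℂ] ℂ, IsHaarFunctional h
  haar_pos : ∀ h : A →ₗ[ℂ] ℂ, IsHaarFunctional h → ∀ a : A, a ≠ 0 → 0 < h (star a * a)

/-- The Haar functional of a compact quantum group algebra. -/
def IsCQGA.haar {A : Type*} [Ring A] [HopfAlgebra ℂ A] [StarRing A] [StarModule ℂ A]
    (hA : IsCQGA A) : A →ₗ[ℂ] ℂ :=
  hA.existsUnique_haar.choose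

theorem IsCQGA.isHaarFunctional_haar {A : Type*} [Ring A] [HopfAlgebra ℂ A] [StarRing A]
    [StarModule ℂ A] (hA : IsCQGA A) : IsHaarFunctional hA.haar :=
  hA.existsUnique_haar.choose_spec.1

/-- A CQGA homogeneous space: a surjective Hopf `*`-algebra map `π : A → H` between compact
quantum group algebras. -/
structure HomogeneousSpace (A H : Type*) [Ring A] [HopfAlgebra ℂ A] [StarRing A] [StarModule ℂ A]
    [Ring H] [HopfAlgebra ℂ H] [StarRing H] [StarModule ℂ H] where
  isCQGA_left : IsCQGA A
  isCQGA_right : IsCQGA H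
  π : A →ₐc[ℂ] H
  surjective : Function.Surjective π
  map_star : ∀ a : A, π (star a) = star (π a)

namespace HomogeneousSpace

variable {A H : Type*} [Ring A] [HopfAlgebra ℂ A] [StarRing A] [StarModule ℂ A]
  [Ring H] [HopfAlgebra ℂ H] [StarRing H] [StarModule ℂ H]

/-- The homogeneous right `H`-coaction `(id ⊗ π) ∘ Δ` on `A`. -/
def rightCoaction (Q : HomogeneousSpace A H) : A →ₐ[ℂ] A ⊗[ℂ] H :=
  (Algebra.TensorProduct.map (AlgHom.id ℂ A) (Q.π : A →ₐ[ℂ] H)).comp (Bialgebra.comulAlgHom ℂ A)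

theorem rightCoaction_star (Q : HomogeneousSpace A H) (a : A) :
    Q.rightCoaction (star a) = star (Q.rightCoaction a) := by
  have key : ∀ t : A ⊗[ℂ] A,
      Algebra.TensorProduct.map (AlgHom.id ℂ A) (Q.π : A →ₐ[ℂ] H) (star t)
        = star (Algebra.TensorProduct.map (AlgHom.id ℂ A) (Q.π : A →ₐ[ℂ] H) t) := by
    intro t
    induction t with
    | zero => simp
    | tmul x y => simp [Q.map_star]
    | add x y hx hy => rw [star_add, map_add, hx, hy, map_add, star_add]
  simp only [rightCoaction, AlgHom.comp_apply, Bialgebra.comulAlgHom_apply]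
  rw [Q.isCQGA_left.comul_star, key]

/-- The quantum homogeneous space `B = A^{co(H)}`, the `*`-subalgebra of all `a ∈ A` with
`(id ⊗ π) Δ(a) = a ⊗ 1`. -/
def coinv (Q : HomogeneousSpace A H) : StarSubalgebra ℂ A where
  carrier := {a | Q.rightCoaction a = a ⊗ₜ[ℂ] (1 : H)}
  mul_mem' := by
    intro a b ha hb
    simp only [Set.mem_ofPred_eq] at *
    rw [map_mul, ha, hb, Algebra.TensorProduct.tmul_mul_tmul, one_mul]
  add_mem' := by
    intro a b ha hb
    simp only [Set.mem_ofPred_eq] at *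
    rw [map_add, ha, hb, TensorProduct.add_tmul]
  algebraMap_mem' := by
    intro r
    simp only [Set.mem_ofPred_eq]
    rw [AlgHom.commutes]
    rfl
  star_mem' := by
    intro a ha
    simp only [Set.mem_ofPred_eq] at *
    rw [rightCoaction_star, ha, TensorProduct.star_tmul, star_one]

theorem mem_coinv (Q : HomogeneousSpace A H) {a : A} :
    a ∈ Q.coinv ↔ Q.rightCoaction a = a ⊗ₜ[ℂ] (1 : H) := Iff.rfl

/-- The inclusion `B → A` as a linear map. -/
def inclLin (Q : HomogeneousSpace A H) : Q.coinv →ₗ[ℂ] A :=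
  Q.coinv.subtype.toAlgHom.toLinearMap

theorem ker_eq_coinv (Q : HomogeneousSpace A H) (a : A) :
    (Q.rightCoaction.toLinearMap - (TensorProduct.mk ℂ A H).flip 1) a = 0 ↔ a ∈ Q.coinv := by
  rw [mem_coinv, LinearMap.sub_apply, sub_eq_zero]
  rfl

/-- `B` is a left coideal of `A`, that is `Δ(B) ⊆ A ⊗ B`. -/
theorem comul_mem_range (Q : HomogeneousSpace A H) (b : Q.coinv) :
    Coalgebra.comul (R := ℂ) (b : A) ∈ LinearMap.range (Q.inclLin.lTensor A) := by
  have hex : Function.Exact Q.inclLin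
      (Q.rightCoaction.toLinearMap - (TensorProduct.mk ℂ A H).flip 1) := by
    intro a
    rw [ker_eq_coinv]
    exact ⟨fun h => ⟨⟨a, h⟩, rfl⟩, by rintro ⟨x, rfl⟩; exact x.2⟩
  have hex' := Module.Flat.lTensor_exact (R := ℂ) A hex
  refine (hex' _).1 ?_
  rw [LinearMap.lTensor_sub, LinearMap.sub_apply, sub_eq_zero]
  have h1 : (Q.rightCoaction.toLinearMap).lTensor A (Coalgebra.comul (R := ℂ) (b : A))
      = TensorProduct.assoc ℂ A A H
          ((Coalgebra.comul (R := ℂ) (A := A)).rTensor H (Q.rightCoaction (b : A))) := by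
    have e1 : ∀ t : A ⊗[ℂ] A, (Q.rightCoaction.toLinearMap).lTensor A t
        = ((Q.π : A →ₐ[ℂ] H).toLinearMap.lTensor A).lTensor A
          ((Coalgebra.comul (R := ℂ) (A := A)).lTensor A t) := by
      intro t
      induction t with
      | zero => simp
      | tmul x y => rfl
      | add x y hx hy => rw [map_add, hx, hy, map_add, map_add]
    have e2 : ∀ t : (A ⊗[ℂ] A) ⊗[ℂ] A,
        ((Q.π : A →ₐ[ℂ] H).toLinearMap.lTensor A).lTensor A (TensorProduct.assoc ℂ A A A t)
          = TensorProduct.assoc ℂ A A H ((Q.π : A →ₐ[ℂ] H).toLinearMap.lTensor (A ⊗[ℂ] A) t) := by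
      intro t
      induction t with
      | zero => simp
      | tmul x y =>
        induction x with
        | zero => simp
        | tmul x z => rfl
        | add u v hu hv => rw [TensorProduct.add_tmul, map_add, map_add, hu, hv, map_add, map_add]
      | add x y hx hy => rw [map_add, map_add, hx, hy, map_add, map_add]
    have e3 : ∀ t : A ⊗[ℂ] A,
        (Q.π : A →ₐ[ℂ] H).toLinearMap.lTensor (A ⊗[ℂ] A)
            ((Coalgebra.comul (R := ℂ) (A := A)).rTensor A t)
          = (Coalgebra.comul (R := ℂ) (A := A)).rTensor H
            ((Q.π : A →ₐ[ℂ] H).toLinearMap.lTensor A t) := by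
      intro t
      induction t with
      | zero => simp
      | tmul x y => rfl
      | add x y hx hy => simp only [map_add, hx, hy]
    rw [e1, ← Coalgebra.coassoc_apply, e2, e3]
    rfl
  rw [h1, Q.mem_coinv.1 b.2, LinearMap.rTensor_tmul]
  generalize Coalgebra.comul (R := ℂ) (b : A) = t
  induction t with
  | zero => simp
  | tmul x y => rfl
  | add x y hx hy => rw [TensorProduct.add_tmul, map_add, hx, hy, map_add]

theorem inclLin_injective (Q : HomogeneousSpace A H) :
    Function.Injective (Q.inclLin.lTensor A) :=
  Module.Flat.lTensor_preserves_injective_linearMap _ Subtype.val_injective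

/-- The left `A`-coaction `Δ_L : B → A ⊗ B` on `B`, the restriction of the coproduct of `A`. -/
def leftCoaction (Q : HomogeneousSpace A H) : Q.coinv →ₗ[ℂ] A ⊗[ℂ] Q.coinv :=
  (LinearEquiv.ofInjective _ Q.inclLin_injective).symm.toLinearMap ∘ₗ
    LinearMap.codRestrict _ ((Coalgebra.comul (R := ℂ) (A := A)) ∘ₗ Q.inclLin) Q.comul_mem_range

theorem lTensor_leftCoaction (Q : HomogeneousSpace A H) (b : Q.coinv) :
    Q.inclLin.lTensor A (Q.leftCoaction b) = Coalgebra.comul (R := ℂ) (b : A) := by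
  have := LinearEquiv.apply_symm_apply (LinearEquiv.ofInjective _ Q.inclLin_injective)
    ⟨Coalgebra.comul (R := ℂ) (b : A), Q.comul_mem_range b⟩
  exact congrArg Subtype.val this

end HomogeneousSpace

/-! ### Differential `*`-calculi and their complex and Hermitian structures -/

/-- A differential `*`-calculus over the `*`-algebra `B`: an `ℕ`-graded differential algebra
`Ω = ⨁ₖ Ωᵏ` with `Ω⁰ = B` (via `incl`), generated in degree zero as a differential graded
algebra, with a conjugate linear involution extending the one of `B`, commuting with `d`, and
satisfying the graded antimultiplicativity rule. -/
structure DiffStarCalculus (B Ω : Type*) [Ring B] [Algebra ℂ B] [StarRing B]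
    [Ring Ω] [Algebra ℂ Ω] where
  deg : ℕ → Submodule ℂ Ω
  [gradedAlgebra : GradedAlgebra deg]
  incl : B →ₐ[ℂ] Ω
  incl_injective : Function.Injective incl
  range_incl : LinearMap.range incl.toLinearMap = deg 0
  d : Ω →ₗ[ℂ] Ω
  d_mem : ∀ k, ∀ ω ∈ deg k, d ω ∈ deg (k + 1)
  d_d : ∀ ω, d (d ω) = 0
  leibniz : ∀ k, ∀ ω ∈ deg k, ∀ ν, d (ω * ν) = d ω * ν + (-1 : ℂ) ^ k • (ω * d ν)
  generated : Algebra.adjoin ℂ (Set.range incl ∪ Set.range (fun b => d (incl b))) = ⊤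
  conj : Ω →ₗ⋆[ℂ] Ω
  conj_conj : ∀ ω, conj (conj ω) = ω
  conj_incl : ∀ b, conj (incl b) = incl (star b)
  conj_d : ∀ ω, conj (d ω) = d (conj ω)
  conj_mul : ∀ k l, ∀ ω ∈ deg k, ∀ ν ∈ deg l,
    conj (ω * ν) = (-1 : ℂ) ^ (k * l) • (conj ν * conj ω)

attribute [instance] DiffStarCalculus.gradedAlgebra

namespace DiffStarCalculus

variable {B Ω : Type*} [Ring B] [Algebra ℂ B] [StarRing B] [Ring Ω] [Algebra ℂ Ω]

/-- The projection of `Ω` onto `Ωᵏ`. -/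
def proj (C : DiffStarCalculus B Ω) (k : ℕ) : Ω →ₗ[ℂ] Ω :=
  GradedAlgebra.proj C.deg k

theorem proj_zero_mem (C : DiffStarCalculus B Ω) (ω : Ω) :
    C.proj 0 ω ∈ LinearMap.range C.incl.toLinearMap := by
  rw [C.range_incl]
  exact SetLike.coe_mem (DirectSum.decompose C.deg ω 0)

/-- The degree zero component of a form, as an element of `B = Ω⁰`. -/
def degZero (C : DiffStarCalculus B Ω) : Ω →ₗ[ℂ] B :=
  (LinearEquiv.ofInjective C.incl.toLinearMap C.incl_injective).symm.toLinearMap ∘ₗ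
    LinearMap.codRestrict _ (C.proj 0) C.proj_zero_mem

theorem incl_degZero (C : DiffStarCalculus B Ω) (ω : Ω) :
    C.incl (C.degZero ω) = C.proj 0 ω :=
  congrArg Subtype.val (LinearEquiv.apply_symm_apply
    (LinearEquiv.ofInjective C.incl.toLinearMap C.incl_injective)
    ⟨C.proj 0 ω, C.proj_zero_mem ω⟩)

/-- The calculus has total degree `m`: `Ωᵐ ≠ 0` and `Ωᵏ = 0` for all `k > m`. -/
def HasTotalDegree (C : DiffStarCalculus B Ω) (m : ℕ) : Prop :=
  C.deg m ≠ ⊥ ∧ ∀ k, m < k → C.deg k = ⊥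

end DiffStarCalculus

/-- A complex structure on a differential `*`-calculus. -/
structure ComplexStructure {B Ω : Type*} [Ring B] [Algebra ℂ B] [StarRing B] [Ring Ω]
    [Algebra ℂ Ω] (C : DiffStarCalculus B Ω) where
  bideg : ℕ × ℕ → Submodule ℂ Ω
  [bigradedAlgebra : GradedAlgebra bideg]
  deg_eq : ∀ k, C.deg k = ⨆ (p : ℕ × ℕ) (_ : p.1 + p.2 = k), bideg p
  conj_bideg : ∀ a b, (bideg (a, b)).map C.conj = bideg (b, a)
  integrable : ∀ a b, (bideg (a, b)).map C.d ≤ bideg (a + 1, b) ⊔ bideg (a, b + 1)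

attribute [instance] ComplexStructure.bigradedAlgebra

namespace ComplexStructure

variable {B Ω : Type*} [Ring B] [Algebra ℂ B] [StarRing B] [Ring Ω] [Algebra ℂ Ω]
  {C : DiffStarCalculus B Ω}

/-- The linear map which is `proj_{Ω^{p + s}} ∘ d` on `Ω^p`, for every bidegree `p`. -/
def shiftPart (K : ComplexStructure C) (s : ℕ × ℕ) : Ω →ₗ[ℂ] Ω :=
  DirectSum.toModule ℂ (ℕ × ℕ) Ω
      (fun p => GradedAlgebra.proj K.bideg (p + s) ∘ₗ C.d ∘ₗ (K.bideg p).subtype) ∘ₗ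
    (DirectSum.decomposeLinearEquiv K.bideg).toLinearMap

/-- `∂`, equal to `proj_{Ω^{(a+1,b)}} ∘ d` on `Ω^{(a,b)}`. -/
def del (K : ComplexStructure C) : Ω →ₗ[ℂ] Ω := K.shiftPart (1, 0)

/-- `∂̄`, equal to `proj_{Ω^{(a,b+1)}} ∘ d` on `Ω^{(a,b)}`. -/
def delBar (K : ComplexStructure C) : Ω →ₗ[ℂ] Ω := K.shiftPart (0, 1)

end ComplexStructure

/-- A Hermitian structure, on a differential `*`-calculus of total degree `2n`: a complex structure
and a central real `(1,1)`-form `σ` such that `L_σ^{n-k} : Ωᵏ → Ω^{2n-k}` is an isomorphism for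
`k = 0, …, n - 1`, where `L_σ(ω) = σ ∧ ω`. -/
structure HermitianStructure {B Ω : Type*} [Ring B] [Algebra ℂ B] [StarRing B] [Ring Ω]
    [Algebra ℂ Ω] (C : DiffStarCalculus B Ω) extends ComplexStructure C where
  n : ℕ
  totalDegree : C.HasTotalDegree (2 * n)
  σ : Ω
  σ_mem : σ ∈ bideg (1, 1)
  σ_central : ∀ ω, σ * ω = ω * σ
  σ_real : C.conj σ = σ
  lefschetz : ∀ k, k < n →
    Set.BijOn (fun ω => ((LinearMap.mulLeft ℂ σ) ^ (n - k)) ω) (C.deg k) (C.deg (2 * n - k))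

namespace HermitianStructure

variable {B Ω : Type*} [Ring B] [Algebra ℂ B] [StarRing B] [Ring Ω] [Algebra ℂ Ω]
  {C : DiffStarCalculus B Ω}

/-- The Lefschetz operator `L_σ`. -/
def L (K : HermitianStructure C) : Ω →ₗ[ℂ] Ω := LinearMap.mulLeft ℂ K.σ

/-- The space `P^{(a,b)}` of primitive `(a,b)`-forms. -/
def primitive (K : HermitianStructure C) (a b : ℕ) : Submodule ℂ Ω :=
  if a + b ≤ K.n then K.bideg (a, b) ⊓ LinearMap.ker (K.L ^ (K.n - (a + b) + 1)) else ⊥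

/-- The defining property of the Hodge map: for `ω ∈ P^{(a,b)}`, with `k = a + b`, and `j ≤ n - k`,
`∗(L^j ω) = (-1)^{k(k+1)/2} i^{a-b} (j! / (n-j-k)!) L^{n-j-k} ω`. -/
def IsHodgeMap (K : HermitianStructure C) (T : Ω →ₗ[ℂ] Ω) : Prop :=
  ∀ a b j : ℕ, a + b + j ≤ K.n → ∀ ω ∈ K.primitive a b,
    T ((K.L ^ j) ω) =
      ((-1 : ℂ) ^ ((a + b) * (a + b + 1) / 2) * Complex.I ^ ((a : ℤ) - (b : ℤ)) *
        ((j ! : ℂ) / ((K.n - j - (a + b))! : ℂ))) • (K.L ^ (K.n - j - (a + b))) ω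

open Classical in
/-- The Hodge map `∗_σ`, the linear map determined by `IsHodgeMap`. (It exists and is
unique, by the Lefschetz decomposition of forms.) -/
def hodge (K : HermitianStructure C) : Ω →ₗ[ℂ] Ω :=
  if h : ∃ T : Ω →ₗ[ℂ] Ω, K.IsHodgeMap T then h.choose else 0

/-- The metric `g_σ : Ω × Ω → B`: `g_σ(ω, ν) = ∗(ω ∧ ∗(ν*))` for `ω, ν` of the same degree, and
`g_σ(Ωᵏ, Ωˡ) = 0` for `k ≠ l`. -/
def metric (K : HermitianStructure C) (ω ν : Ω) : B :=
  ∑ k ∈ Finset.range (2 * K.n + 1),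
    C.degZero (K.hodge (C.proj k ω * K.hodge (C.conj (C.proj k ν))))

/-- Positivity: `g_σ(ω, ω)` is, for `ω ≠ 0`, a nonzero element of the cone of finite sums
`∑ bᵢ* bᵢ`. -/
def IsPositive (K : HermitianStructure C) : Prop :=
  ∀ ω : Ω, ω ≠ 0 → K.metric ω ω ≠ 0 ∧
    ∃ (l : ℕ) (b : Fin l → B), K.metric ω ω = ∑ i, star (b i) * b i

end HermitianStructure

/-! ### Covariance, and CQH-Hermitian spaces -/

/-- A left `A`-covariant differential `*`-calculus over `B = A^{co(H)}`: the coaction of `A` on `B`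
extends to a left `A`-comodule algebra structure on `Ω` for which `d` is a comodule map. -/
structure CovariantCalculus {A H : Type*} [Ring A] [HopfAlgebra ℂ A] [StarRing A] [StarModule ℂ A]
    [Ring H] [HopfAlgebra ℂ H] [StarRing H] [StarModule ℂ H] (Q : HomogeneousSpace A H)
    (Ω : Type*) [Ring Ω] [Algebra ℂ Ω] extends DiffStarCalculus Q.coinv Ω where
  coact : Ω →ₐ[ℂ] A ⊗[ℂ] Ω
  coassoc : ∀ ω, TensorProduct.assoc ℂ A A Ω
      ((Coalgebra.comul (R := ℂ) (A := A)).rTensor Ω (coact ω)) =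
    coact.toLinearMap.lTensor A (coact ω)
  counit : ∀ ω, TensorProduct.lid ℂ Ω
    ((Coalgebra.counit (R := ℂ) (A := A)).rTensor Ω (coact ω)) = ω
  coact_incl : ∀ b, coact (incl b) = incl.toLinearMap.lTensor A (Q.leftCoaction b)
  coact_d : ∀ ω, coact (d ω) = d.lTensor A (coact ω)

namespace CovariantCalculus

variable {A H : Type*} [Ring A] [HopfAlgebra ℂ A] [StarRing A] [StarModule ℂ A]
  [Ring H] [HopfAlgebra ℂ H] [StarRing H] [StarModule ℂ H] {Q : HomogeneousSpace A H}
  {Ω : Type*} [Ring Ω] [Algebra ℂ Ω]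

/-- `V` is a left `A`-subcomodule of `Ω`, that is `Δ_L(V) ⊆ A ⊗ V`. -/
def IsSubcomodule (C : CovariantCalculus Q Ω) (V : Submodule ℂ Ω) : Prop :=
  ∀ ω ∈ V, C.coact ω ∈ LinearMap.range (V.subtype.lTensor A)

/-- The image in `Ω` of `B⁺ = B ∩ ker ε`. -/
def augmentation (C : CovariantCalculus Q Ω) : Submodule ℂ Ω :=
  (LinearMap.ker ((Coalgebra.counit (R := ℂ) (A := A)) ∘ₗ Q.inclLin)).map C.incl.toLinearMap

/-- `Ω` is an object of the category `^A_B mod₀`: `Ω` is finitely generated as a left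
`B`-module, and `Ω B⁺ = B⁺ Ω`. (Compatibility of the coaction with the left `B`-module structure is
part of being a comodule algebra.) -/
def IsObject (C : CovariantCalculus Q Ω) : Prop :=
  (∃ s : Finset Ω, ∀ ω : Ω, ∃ c : Ω → Q.coinv, ω = ∑ x ∈ s, C.incl (c x) * x) ∧
    (⊤ : Submodule ℂ Ω) * C.augmentation = C.augmentation * ⊤

end CovariantCalculus

/-- A compact quantum homogeneous Hermitian space `(B = A^{co(H)}, Ω^•, Ω^{(•,•)}, σ)`. -/
structure HermitianSpace (A H Ω : Type*) [Ring A] [HopfAlgebra ℂ A] [StarRing A]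
    [StarModule ℂ A] [Ring H] [HopfAlgebra ℂ H] [StarRing H] [StarModule ℂ H] [Ring Ω]
    [Algebra ℂ Ω] where
  /-- `B = A^{co(H)}` is a CQGA homogeneous space. -/
  Q : HomogeneousSpace A H
  /-- `Ω` is a left `A`-covariant differential `*`-calculus over `B` … -/
  C : CovariantCalculus Q Ω
  /-- … and an object of `^A_B mod₀`. -/
  isObject : C.IsObject
  /-- The Hermitian structure. -/
  K : HermitianStructure C.toDiffStarCalculus
  /-- The Hermitian structure is covariant: each `Ω^{(a,b)}` is a subcomodule … -/
  covariant_bideg : ∀ p, C.IsSubcomodule (K.bideg p)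
  /-- … and `σ` is left coinvariant. -/
  covariant_σ : C.coact K.σ = (1 : A) ⊗ₜ[ℂ] K.σ
  /-- The integral `∫ = haar ∘ ∗_σ : Ω^{2n} → ℂ` is closed. -/
  closed : ∀ k, k + 1 = 2 * K.n → ∀ ω ∈ C.deg k,
    Q.isCQGA_left.haar (Q.inclLin (C.degZero (K.hodge (C.d ω)))) = 0
  /-- The metric is positive. -/
  positive : K.IsPositive

namespace HermitianSpace

variable {A H Ω : Type*} [Ring A] [HopfAlgebra ℂ A] [StarRing A] [StarModule ℂ A]
  [Ring H] [HopfAlgebra ℂ H] [StarRing H] [StarModule ℂ H] [Ring Ω] [Algebra ℂ Ω]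

/-- The pairing `⟨ω, ν⟩_σ = haar (g_σ(ω, ν))`, linear in `ω` and conjugate linear in `ν`. -/
def pairing (S : HermitianSpace A H Ω) (ω ν : Ω) : ℂ :=
  S.Q.isCQGA_left.haar (S.Q.inclLin (S.K.metric ω ν))

theorem pairing_add_left (S : HermitianSpace A H Ω) (x y z : Ω) :
    S.pairing (x + y) z = S.pairing x z + S.pairing y z := by
  simp [pairing, HermitianStructure.metric, add_mul, Finset.sum_add_distrib]

theorem pairing_add_right (S : HermitianSpace A H Ω) (x y z : Ω) :
    S.pairing x (y + z) = S.pairing x y + S.pairing x z := by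
  simp [pairing, HermitianStructure.metric, mul_add, Finset.sum_add_distrib]

theorem pairing_smul_left (S : HermitianSpace A H Ω) (c : ℂ) (x y : Ω) :
    S.pairing (c • x) y = c * S.pairing x y := by
  simp [pairing, HermitianStructure.metric, Finset.mul_sum]

theorem pairing_smul_right (S : HermitianSpace A H Ω) (c : ℂ) (x y : Ω) :
    S.pairing x (c • y) = starRingEnd ℂ c * S.pairing x y := by
  simp [pairing, HermitianStructure.metric, Finset.mul_sum]

theorem pairing_self_pos (S : HermitianSpace A H Ω) (x : Ω) (hx : x ≠ 0) :
    0 < S.pairing x x := by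
  obtain ⟨h0, l, b, hb⟩ := S.positive x hx
  have hp := S.Q.isCQGA_left.haar_pos _ S.Q.isCQGA_left.isHaarFunctional_haar
  have hi : ∀ i, S.Q.inclLin (star (b i) * b i) = star (b i : A) * (b i : A) := fun i => rfl
  have hnn : ∀ a : A, 0 ≤ S.Q.isCQGA_left.haar (star a * a) := by
    intro a
    by_cases ha : a = 0
    · simp [ha]
    · exact (hp a ha).le
  rw [pairing, hb, map_sum, map_sum]
  simp only [hi]
  have : ∃ i, b i ≠ 0 := by
    by_contra hcon
    push Not at hcon
    exact h0 (by rw [hb]; simp [hcon])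
  obtain ⟨i, hi'⟩ := this
  refine Finset.sum_pos' (fun j _ => hnn _) ⟨i, Finset.mem_univ _, hp _ ?_⟩
  exact fun h => hi' (Subtype.ext h)

theorem pairing_self_im (S : HermitianSpace A H Ω) (x : Ω) : (S.pairing x x).im = 0 := by
  by_cases hx : x = 0
  · subst hx
    have := S.pairing_smul_left 0 0 (0 : Ω)
    simp only [zero_smul, zero_mul] at this
    simp [this]
  · exact ((Complex.pos_iff.1 (S.pairing_self_pos x hx)).2).symm

theorem pairing_conj (S : HermitianSpace A H Ω) (x y : Ω) :
    starRingEnd ℂ (S.pairing x y) = S.pairing y x := by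
  have h1 := S.pairing_self_im (x + y)
  have h2 := S.pairing_self_im (x + Complex.I • y)
  have hx := S.pairing_self_im x
  have hy := S.pairing_self_im y
  simp only [pairing_add_left, pairing_add_right, pairing_smul_left, pairing_smul_right,
    Complex.add_im, Complex.add_re, Complex.mul_im, Complex.conj_I, Complex.I_re, Complex.I_im, Complex.neg_re,
    Complex.neg_im, Complex.mul_re] at h1 h2
  apply Complex.ext
  · simp only [Complex.conj_re]; linarith
  · simp only [Complex.conj_im]; linarith

/-- The space of forms `Ω^•` of a CQH-Hermitian space, to be equipped with its inner product. -/
def Forms (_S : HermitianSpace A H Ω) : Type _ := Ω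

instance (S : HermitianSpace A H Ω) : AddCommGroup S.Forms := inferInstanceAs (AddCommGroup Ω)

instance (S : HermitianSpace A H Ω) : Module ℂ S.Forms := inferInstanceAs (Module ℂ Ω)

/-- The inner product. The inner product of Mathlib is conjugate linear in the first variable,
so that `⟪ω, ν⟫ = ⟨ν, ω⟩_σ`. -/
abbrev innerCore (S : HermitianSpace A H Ω) : InnerProductSpace.Core ℂ S.Forms where
  inner ω ν := S.pairing ν ω
  conj_inner_symm ω ν := S.pairing_conj ω ν
  re_inner_nonneg ω := by
    by_cases h : ω = 0
    · subst h
      have := S.pairing_smul_left 0 0 (0 : Ω)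
      simp only [zero_smul, zero_mul] at this
      exact (congrArg Complex.re this).ge
    · exact (Complex.pos_iff.1 (S.pairing_self_pos ω h)).1.le
  add_left ω ν ξ := S.pairing_add_right ξ ω ν
  smul_left ω ν c := S.pairing_smul_right c ν ω
  definite ω h := by
    by_contra hne
    exact (S.pairing_self_pos ω hne).ne' h

instance (S : HermitianSpace A H Ω) : NormedAddCommGroup S.Forms :=
  S.innerCore.toNormedAddCommGroup

instance (S : HermitianSpace A H Ω) : InnerProductSpace ℂ S.Forms :=
  InnerProductSpace.ofCore S.innerCore.toCore

/-- `L²(Ω^•)`, the Hilbert space completion of `Ω^•`. -/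
abbrev L2 (S : HermitianSpace A H Ω) : Type _ := UniformSpace.Completion S.Forms

/-- The exterior derivative `d` on `Ω^•`. -/
def d (S : HermitianSpace A H Ω) : S.Forms →ₗ[ℂ] S.Forms := S.C.d

/-- The holomorphic derivative `∂` on `Ω^•`. -/
def del (S : HermitianSpace A H Ω) : S.Forms →ₗ[ℂ] S.Forms := S.K.del

/-- The anti-holomorphic derivative `∂̄` on `Ω^•`. -/
def delBar (S : HermitianSpace A H Ω) : S.Forms →ₗ[ℂ] S.Forms := S.K.delBar

/-- `g` is an adjoint of `f` on `Ω^•`. -/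
def IsAdjoint (S : HermitianSpace A H Ω) (f g : S.Forms →ₗ[ℂ] S.Forms) : Prop :=
  ∀ ω ν : S.Forms, ⟪f ω, ν⟫_ℂ = ⟪ω, g ν⟫_ℂ

open Classical in
/-- The adjoint `f†` of an adjointable map `f : Ω^• → Ω^•` (there is at most one), and `0` if `f` is
not adjointable. -/
def dagger (S : HermitianSpace A H Ω) (f : S.Forms →ₗ[ℂ] S.Forms) : S.Forms →ₗ[ℂ] S.Forms :=
  if h : ∃ g : S.Forms →ₗ[ℂ] S.Forms, S.IsAdjoint f g then h.choose else 0

/-- The Dirac operator `D_f = f + f†`, for `f = d, ∂, ∂̄`. -/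
def dirac (S : HermitianSpace A H Ω) (f : S.Forms →ₗ[ℂ] S.Forms) : S.Forms →ₗ[ℂ] S.Forms :=
  f + S.dagger f

/-- The Laplace operator `Δ_f = (f + f†)²`, for `f = d, ∂, ∂̄`. -/
def laplace (S : HermitianSpace A H Ω) (f : S.Forms →ₗ[ℂ] S.Forms) : S.Forms →ₗ[ℂ] S.Forms :=
  S.dirac f ∘ₗ S.dirac f

/-- A linear map `f : Ω^• → Ω^•`, as an unbounded operator on `L²(Ω^•)` with domain `Ω^•`. -/
def toL2 (S : HermitianSpace A H Ω) (f : S.Forms →ₗ[ℂ] S.Forms) : S.L2 →ₗ.[ℂ] S.L2 where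
  domain := LinearMap.range
    (UniformSpace.Completion.toComplₗᵢ (𝕜 := ℂ) (E := S.Forms)).toLinearMap
  toFun := (UniformSpace.Completion.toComplₗᵢ (𝕜 := ℂ) (E := S.Forms)).toLinearMap ∘ₗ f ∘ₗ
    (LinearEquiv.ofInjective
      (UniformSpace.Completion.toComplₗᵢ (𝕜 := ℂ) (E := S.Forms)).toLinearMap
      (UniformSpace.Completion.toComplₗᵢ (𝕜 := ℂ) (E := S.Forms)).injective).symm.toLinearMap

end HermitianSpace

/-! ### Unbounded operators -/

/-- An unbounded operator is diagonalisable if its domain contains an orthonormal (Hilbert) basis of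
the Hilbert space that consists of eigenvectors. -/
def IsDiagonalisable {E : Type*} [NormedAddCommGroup E] [InnerProductSpace ℂ E]
    (T : E →ₗ.[ℂ] E) : Prop :=
  ∃ (w : Set E) (e : HilbertBasis w ℂ E), (∀ i : w, e i = (i : E)) ∧
    ∀ i : w, ∃ (hi : (i : E) ∈ T.domain) (c : ℂ), T ⟨i, hi⟩ = c • (i : E)

/-- A densely defined operator is essentially self-adjoint if it is closable, with self-adjoint
closure. -/
def IsEssentiallySelfAdjoint {E : Type*} [NormedAddCommGroup E] [InnerProductSpace ℂ E]
    [CompleteSpace E] (T : E →ₗ.[ℂ] E) : Prop :=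
  Dense (T.domain : Set E) ∧ T.IsClosable ∧ IsSelfAdjoint T.closure

end CQH

end

/-!
# Dirac and Laplace operators of a CQH-Hermitian space

The linear dual of `A` acts on `Ω^•` by the operators `T_χ = (χ ⊗ id) Δ_L`. The maps `d`, `∂`, `∂̄`
are comodule maps, so they commute with every `T_χ`, and everything follows from three properties
of this action.

* It is unitary: the adjoint of `T_χ` is `T_{χ†}` with `χ†(a) = conj χ(S(a)*)`
  (`HermitianSpace.pairing_act_left`). This is the invariance of the inner product under the
  coaction, which combines the invariance of the Haar functional, the covariance of the involution
  (`CovariantCalculus.coact_conj`) and that of the Hodge map (`HermitianStructure.IsHodgeMap.comm`);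
  the last one rests on the Lefschetz decomposition
  (`HermitianStructure.lefschetzSpan_eq_top`), because the Hodge map is only prescribed on forms
  `L^j ω` with `ω` primitive.
* It is locally finite, as is every coaction (`CovariantCalculus.finite_range_act`).
* It has finite multiplicities (`CovariantCalculus.finiteDimensional_of_act_eq_zero`). The fibre
  `Ω / B⁺Ω` is finite-dimensional, since `Ω` is a finitely generated left `B`-module, and a form is
  determined by the classes of all its translates `T_χ ω` in the fibre
  (`CovariantCalculus.eq_zero_of_act_mem_fibreKer`). For this injectivity, which is the part of
  Takeuchi's equivalence that is needed, the Haar functional of `H` provides a right `B`-linear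
  conditional expectation `E : A → B`, and `a ⊗ [ω] ↦ E(a S(ω₍₋₁₎)) ω₍₀₎` recovers `ω` from
  `ω₍₋₁₎ ⊗ [ω₍₀₎]`.

For such an action, every operator in the commutant is reduced by each of the finite-dimensional
isotypic subspaces, which exhaust the space (`IsUnitaryAction.mapsTo_isotypic_orthogonal`). So it is
adjointable with adjoint in the commutant, and a symmetric one has an orthonormal basis of
eigenvectors with real eigenvalues (`IsUnitaryAction.exists_orthonormal_eigenvectors`). A symmetric
unbounded operator with such a basis in its domain is essentially self-adjoint
(`isEssentiallySelfAdjoint_of_hilbertBasis`).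
-/

noncomputable section

namespace CQH

/-! ### Commutants of locally finite self-adjoint families of operators -/

section Commutant

variable {E : Type*} [NormedAddCommGroup E] [InnerProductSpace ℂ E]

/-- `W` is invariant under every operator of the family `𝒯`. -/
def IsInvariant (𝒯 : Set (E →ₗ[ℂ] E)) (W : Submodule ℂ E) : Prop :=
  ∀ t ∈ 𝒯, ∀ x ∈ W, t x ∈ W

/-- The vectors killed by every operator of `𝒯` that kills `W`. For `𝒯` the action of the dual
algebra of a coalgebra, these are the vectors whose matrix coefficients are among those of `W`;
for an irreducible `W` it is the isotypic component of `W`. -/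
def isotypic (𝒯 : Set (E →ₗ[ℂ] E)) (W : Submodule ℂ E) : Submodule ℂ E where
  carrier := {x | ∀ t ∈ 𝒯, (∀ w ∈ W, t w = 0) → t x = 0}
  add_mem' hx hy t ht h := by rw [map_add, hx t ht h, hy t ht h, add_zero]
  zero_mem' t _ _ := map_zero t
  smul_mem' c x hx t ht h := by rw [map_smul, hx t ht h, smul_zero]

theorem le_isotypic (𝒯 : Set (E →ₗ[ℂ] E)) (W : Submodule ℂ E) : W ≤ isotypic 𝒯 W :=
  fun x hx _ _ h => h x hx

/-- A family of operators that behaves like the action of the dual algebra of a cosemisimple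
coalgebra on a unitary comodule with finite multiplicities: it is closed under composition and
adjoints, acts locally finitely, and has finite-dimensional isotypic subspaces. -/
structure IsUnitaryAction (𝒯 : Set (E →ₗ[ℂ] E)) : Prop where
  comp_mem : ∀ s ∈ 𝒯, ∀ t ∈ 𝒯, s ∘ₗ t ∈ 𝒯
  exists_adjoint : ∀ t ∈ 𝒯, ∃ t' ∈ 𝒯, ∀ x y, ⟪t x, y⟫_ℂ = ⟪x, t' y⟫_ℂ
  locally_finite : ∀ x, ∃ W : Submodule ℂ E, FiniteDimensional ℂ W ∧ IsInvariant 𝒯 W ∧ x ∈ W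
  finite_isotypic : ∀ W : Submodule ℂ E, FiniteDimensional ℂ W → IsInvariant 𝒯 W →
    FiniteDimensional ℂ (isotypic 𝒯 W)

/-- `f` commutes with every operator of the family `𝒯`. -/
def InCommutant (𝒯 : Set (E →ₗ[ℂ] E)) (f : E →ₗ[ℂ] E) : Prop :=
  ∀ t ∈ 𝒯, ∀ x, f (t x) = t (f x)

variable {𝒯 : Set (E →ₗ[ℂ] E)} {W V : Submodule ℂ E} {f g : E →ₗ[ℂ] E}

theorem InCommutant.mapsTo_isotypic (hf : InCommutant 𝒯 f) {x : E} (hx : x ∈ isotypic 𝒯 W) :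
    f x ∈ isotypic 𝒯 W := fun t ht h => by
  rw [← hf t ht, hx t ht h, map_zero]

namespace IsUnitaryAction

variable (h𝒯 : IsUnitaryAction 𝒯)
include h𝒯

theorem isInvariant_isotypic (hW : IsInvariant 𝒯 W) : IsInvariant 𝒯 (isotypic 𝒯 W) :=
  fun t ht _ hx s hs h => hx (s ∘ₗ t) (h𝒯.comp_mem s hs t ht) fun w hw => h _ (hW t ht w hw)

theorem isInvariant_orthogonal (hW : IsInvariant 𝒯 W) : IsInvariant 𝒯 Wᗮ := by
  intro t ht x hx w hw
  obtain ⟨t', ht', h⟩ := h𝒯.exists_adjoint t ht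
  rw [← inner_conj_symm, h, inner_conj_symm]
  exact hx _ (hW t' ht' w hw)

end IsUnitaryAction

theorem IsInvariant.inf (hV : IsInvariant 𝒯 V) (hW : IsInvariant 𝒯 W) : IsInvariant 𝒯 (V ⊓ W) :=
  fun t ht x hx => ⟨hV t ht x hx.1, hW t ht x hx.2⟩

theorem InCommutant.isInvariant_ker (hf : InCommutant 𝒯 f) : IsInvariant 𝒯 (LinearMap.ker f) :=
  fun t ht x hx => by
    rw [LinearMap.mem_ker] at *
    rw [hf t ht, hx, map_zero]

/-- The orthogonal projection onto `V`, as a linear map `E → E`. -/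
def projOnto (V : Submodule ℂ E) [V.HasOrthogonalProjection] : E →ₗ[ℂ] E :=
  V.starProjection.toLinearMap

section projOnto

variable [V.HasOrthogonalProjection]

theorem projOnto_mem (x : E) : projOnto V x ∈ V := Submodule.starProjection_apply_mem V x

theorem projOnto_of_mem {x : E} (hx : x ∈ V) : projOnto V x = x :=
  Submodule.starProjection_eq_self_iff.2 hx

theorem projOnto_of_mem_orthogonal {x : E} (hx : x ∈ Vᗮ) : projOnto V x = 0 :=
  (Submodule.starProjection_apply_eq_zero_iff V).2 hx

theorem sub_projOnto_mem (x : E) : x - projOnto V x ∈ Vᗮ :=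
  Submodule.sub_starProjection_mem_orthogonal x

theorem projOnto_isSymmetric : (projOnto V).IsSymmetric :=
  Submodule.starProjection_isSymmetric V

theorem projOnto_comm (h₁ : ∀ x ∈ V, f x ∈ V) (h₂ : ∀ x ∈ Vᗮ, f x ∈ Vᗮ) (x : E) :
    projOnto V (f x) = f (projOnto V x) := by
  conv_lhs => rw [← add_sub_cancel (projOnto V x) x, map_add, map_add,
    projOnto_of_mem (h₁ _ (projOnto_mem x)),
    projOnto_of_mem_orthogonal (h₂ _ (sub_projOnto_mem x)), add_zero]

end projOnto

namespace IsUnitaryAction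

variable (h𝒯 : IsUnitaryAction 𝒯)
include h𝒯

theorem projOnto_inCommutant [V.HasOrthogonalProjection] (hV : IsInvariant 𝒯 V) :
    InCommutant 𝒯 (projOnto V) :=
  fun t ht => projOnto_comm (hV t ht) (h𝒯.isInvariant_orthogonal hV t ht)

/-- A map in the commutant preserves the orthogonal complement of an isotypic subspace. By
complete reducibility, a vector of the complement whose image has a component in the isotypic
subspace would give an isomorphic copy, in the complement, of a piece of the isotypic subspace. -/
theorem mapsTo_isotypic_orthogonal (hW : IsInvariant 𝒯 W) [FiniteDimensional ℂ W]
    (hf : InCommutant 𝒯 f) {x : E} (hx : x ∈ (isotypic 𝒯 W)ᗮ) : f x ∈ (isotypic 𝒯 W)ᗮ := by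
  have hfin : FiniteDimensional ℂ (isotypic 𝒯 W) := h𝒯.finite_isotypic W inferInstance hW
  set V := isotypic 𝒯 W with hVdef
  have hV : IsInvariant 𝒯 V := h𝒯.isInvariant_isotypic hW
  set g : E →ₗ[ℂ] E := projOnto V ∘ₗ f with hgdef
  have hg : InCommutant 𝒯 g := fun t ht x => by
    simp only [hgdef, LinearMap.comp_apply]
    rw [hf t ht, h𝒯.projOnto_inCommutant hV t ht]
  -- `K` is the kernel of `g` in an invariant finite-dimensional subspace `X'` of `Vᗮ` containing
  -- `x`, and the component `y` of `x` orthogonal to `K` turns out to vanish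
  obtain ⟨X, hXfin, hX, hxX⟩ := h𝒯.locally_finite x
  let X' : Submodule ℂ E := X ⊓ Vᗮ
  have hX' : IsInvariant 𝒯 X' := hX.inf (h𝒯.isInvariant_orthogonal hV)
  let K : Submodule ℂ E := X' ⊓ LinearMap.ker g
  have hK : IsInvariant 𝒯 K := hX'.inf hg.isInvariant_ker
  have : FiniteDimensional ℂ X' := Submodule.finiteDimensional_of_le inf_le_left
  have : FiniteDimensional ℂ K := Submodule.finiteDimensional_of_le inf_le_left
  let y := x - projOnto K x
  have hyX : y ∈ X' := X'.sub_mem ⟨hxX, hx⟩ (projOnto_mem (V := K) x).1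
  have hyK : y ∈ Kᗮ := sub_projOnto_mem x
  -- `g` is injective on the orthogonal complement of `K` in `X'`, so an operator that kills `W`,
  -- and hence `V`, kills `y`
  have hyV : y ∈ V := by
    intro t ht h
    have h1 : t y ∈ X' := hX' t ht y hyX
    have h2 : g (t y) = 0 := by
      rw [hg t ht]
      exact projOnto_mem (V := V) (f y) t ht h
    exact K.inner_right_of_mem_orthogonal (u := t y) ⟨h1, h2⟩
      (h𝒯.isInvariant_orthogonal hK t ht y hyK) |> inner_self_eq_zero.1
  have hy0 : y = 0 := inner_self_eq_zero.1 (V.inner_right_of_mem_orthogonal hyV hyX.2)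
  have hgx : g x = 0 := by
    rw [sub_eq_zero.1 hy0]
    exact (projOnto_mem (V := K) x).2
  have := sub_projOnto_mem (V := V) (f x)
  rwa [show projOnto V (f x) = 0 from hgx, sub_zero] at this

/-- Every map in the commutant is adjointable: it is reduced by the finite-dimensional isotypic
subspaces, which exhaust the space. -/
theorem exists_adjoint_of_inCommutant (hf : InCommutant 𝒯 f) :
    ∃ f' : E →ₗ[ℂ] E, ∀ x y, ⟪f x, y⟫_ℂ = ⟪x, f' y⟫_ℂ := by
  have key : ∀ y, ∃ z, ∀ x, ⟪f x, y⟫_ℂ = ⟪x, z⟫_ℂ := by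
    intro y
    obtain ⟨W, hWfin, hW, hyW⟩ := h𝒯.locally_finite y
    have hfin := h𝒯.finite_isotypic W hWfin hW
    set V := isotypic 𝒯 W with hVdef
    have hyV : y ∈ V := le_isotypic 𝒯 W hyW
    let fV : V →ₗ[ℂ] V := f.restrict fun x hx => hf.mapsTo_isotypic hx
    -- the adjoint of the restriction of `f` to `V` works, as `f` commutes with the projection
    refine ⟨LinearMap.adjoint fV ⟨y, hyV⟩, fun x => ?_⟩
    have hcomm : projOnto V (f x) = f (projOnto V x) :=
      projOnto_comm (fun x hx => hf.mapsTo_isotypic hx)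
        (fun x hx => h𝒯.mapsTo_isotypic_orthogonal hW hf hx) x
    have h1 : ⟪f x, y⟫_ℂ = ⟪f (projOnto V x), y⟫_ℂ := by
      rw [← hcomm, projOnto_isSymmetric, projOnto_of_mem hyV]
    have h2 := LinearMap.adjoint_inner_right fV ⟨projOnto V x, projOnto_mem x⟩ ⟨y, hyV⟩
    rw [h1, ← projOnto_of_mem (V := V) (LinearMap.adjoint fV ⟨y, hyV⟩).2, ← projOnto_isSymmetric]
    exact h2.symm
  choose a ha using key
  refine ⟨{ toFun := a, map_add' := fun u v => ?_, map_smul' := fun c u => ?_ },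
    fun x y => ha y x⟩
  · refine ext_inner_left ℂ fun x => ?_
    rw [← ha, inner_add_right, inner_add_right, ha, ha]
  · refine ext_inner_left ℂ fun x => ?_
    rw [← ha, inner_smul_right, RingHom.id_apply, inner_smul_right, ha]

theorem adjoint_inCommutant (hf : InCommutant 𝒯 f) (h : ∀ x y, ⟪f x, y⟫_ℂ = ⟪x, g y⟫_ℂ) :
    InCommutant 𝒯 g := by
  intro t ht y
  obtain ⟨t', ht', h'⟩ := h𝒯.exists_adjoint t ht
  have h'' : ∀ x y, ⟪x, t y⟫_ℂ = ⟪t' x, y⟫_ℂ := fun x y => by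
    rw [← inner_conj_symm, h', inner_conj_symm]
  refine ext_inner_left ℂ fun x => ?_
  rw [← h, h'', h'', ← h, hf t' ht']

/-- A symmetric map in the commutant has an orthonormal eigenbasis. The joint eigenspaces of the
map and of all the projections onto isotypic subspaces are mutually orthogonal, they span, and
every one of them lies in an isotypic subspace, hence has a finite orthonormal basis. -/
theorem exists_orthonormal_eigenvectors (hf : InCommutant 𝒯 f) (hsymm : f.IsSymmetric) :
    ∃ w : Set E, Orthonormal ℂ ((↑) : w → E) ∧ Submodule.span ℂ w = ⊤ ∧
      ∀ x ∈ w, ∃ c : ℝ, f x = (c : ℂ) • x := by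
  let J := {W : Submodule ℂ E // FiniteDimensional ℂ W ∧ IsInvariant 𝒯 W}
  have hfin : ∀ W : J, FiniteDimensional ℂ (isotypic 𝒯 W.1) := fun W =>
    h𝒯.finite_isotypic W.1 W.2.1 W.2.2
  let T : Option J → E →ₗ[ℂ] E := fun o => o.elim f fun W => projOnto (isotypic 𝒯 W.1)
  have hTcomm : ∀ o, InCommutant 𝒯 (T o) := by
    rintro (_ | W)
    · exact hf
    · exact h𝒯.projOnto_inCommutant (h𝒯.isInvariant_isotypic W.2.2)
  have hTsymm : ∀ o, (T o).IsSymmetric := by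
    rintro (_ | W)
    · exact hsymm
    · exact projOnto_isSymmetric
  have hproj : ∀ (o : Option J) (W : J) (x : E),
      projOnto (isotypic 𝒯 W.1) (T o x) = T o (projOnto (isotypic 𝒯 W.1) x) := by
    intro o W x
    have := W.2.1
    exact projOnto_comm (fun x hx => (hTcomm o).mapsTo_isotypic hx)
      (fun x hx => h𝒯.mapsTo_isotypic_orthogonal W.2.2 (hTcomm o) hx) x
  have hcomm : ∀ o o', Commute (T o) (T o') := by
    rintro (_ | W) (_ | W')
    · exact Commute.refl _
    · exact LinearMap.ext fun x => (hproj none W' x).symm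
    · exact LinearMap.ext fun x => hproj none W x
    · exact LinearMap.ext fun x => hproj (some W') W x
  let F : (Option J → ℂ) → Submodule ℂ E := fun χ => ⨅ o, Module.End.eigenspace (T o) (χ o)
  have hF : ∀ χ x, x ∈ F χ ↔ ∀ o, T o x = χ o • x := fun χ x => by
    simp only [F, Submodule.mem_iInf, Module.End.mem_eigenspace_iff]
  have hFfin : ∀ χ, FiniteDimensional ℂ (F χ) := by
    intro χ
    by_cases hbot : F χ = ⊥
    · rw [hbot]; infer_instance
    -- a nonzero `x` lies in some isotypic subspace, whose projection then has eigenvalue `1`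
    obtain ⟨x, hx, hx0⟩ := (F χ).ne_bot_iff.1 hbot
    obtain ⟨W, hWfin, hW, hxW⟩ := h𝒯.locally_finite x
    let W' : J := ⟨W, hWfin, hW⟩
    have h1 : χ (some W') = 1 := by
      have h := (hF χ x).1 hx (some W')
      rw [show T (some W') x = x from projOnto_of_mem (le_isotypic 𝒯 W hxW)] at h
      by_contra hne
      exact smul_ne_zero (sub_ne_zero.2 (Ne.symm hne)) hx0
        (by rw [sub_smul, one_smul, ← h, sub_self])
    refine Submodule.finiteDimensional_of_le (S₂ := isotypic 𝒯 W'.1) fun z hz => ?_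
    have h := (hF χ z).1 hz (some W')
    rw [h1, one_smul] at h
    rw [← h]
    exact projOnto_mem z
  have horth := LinearMap.IsSymmetric.orthogonalFamily_iInf_eigenspaces hTsymm
  have hsup : ⨆ χ, F χ = ⊤ := by
    rw [eq_top_iff]
    rintro x -
    obtain ⟨W, hWfin, hW, hxW⟩ := h𝒯.locally_finite x
    have hVfin := h𝒯.finite_isotypic W hWfin hW
    let V := isotypic 𝒯 W
    have hmaps : ∀ o, ∀ x ∈ V, T o x ∈ V := fun o x hx => (hTcomm o).mapsTo_isotypic hx
    have htop := LinearMap.IsSymmetric.iSup_iInf_eq_top_of_commute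
      (T := fun o => (T o).restrict (hmaps o))
      (fun o => (hTsymm o).restrict_invariant (hmaps o))
      (fun o o' _ => LinearMap.ext fun x => Subtype.ext (LinearMap.congr_fun (hcomm o o') x.1))
    have hx : (⟨x, le_isotypic 𝒯 W hxW⟩ : V) ∈ (⊤ : Submodule ℂ V) := trivial
    rw [← htop] at hx
    have hmap := Submodule.mem_map_of_mem (f := V.subtype) hx
    rw [Submodule.map_iSup] at hmap
    have hle : (⨆ χ : Option J → ℂ, Submodule.map V.subtype
        (⨅ o, Module.End.eigenspace ((T o).restrict (hmaps o)) (χ o))) ≤ ⨆ χ, F χ := by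
      refine iSup_mono fun χ => ?_
      rintro _ ⟨z, hz, rfl⟩
      rw [hF]
      intro o
      have := (Submodule.mem_iInf _).1 hz o
      exact congrArg Subtype.val (Module.End.mem_eigenspace_iff.1 this)
    exact hle hmap
  let b : ∀ χ, OrthonormalBasis (Fin (Module.finrank ℂ (F χ))) ℂ (F χ) := fun χ =>
    stdOrthonormalBasis ℂ (F χ)
  have hon := horth.orthonormal_sigma_orthonormal (v_family := fun χ i => b χ i)
    fun χ => (b χ).orthonormal
  refine ⟨_, hon.toSubtypeRange, ?_, ?_⟩
  · rw [eq_top_iff, ← hsup, iSup_le_iff]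
    intro χ x hx
    have h1 := (b χ).toBasis.mem_span ⟨x, hx⟩
    have h2 := Submodule.mem_map_of_mem (f := (F χ).subtype) h1
    rw [Submodule.map_span] at h2
    refine Submodule.span_mono ?_ h2
    rintro _ ⟨_, ⟨i, rfl⟩, rfl⟩
    exact ⟨⟨χ, i⟩, by simp [F]⟩
  · rintro _ ⟨⟨χ, i⟩, rfl⟩
    have h := (hF χ _).1 (b χ i).2 none
    have hne : ((b χ i : F χ) : E) ≠ 0 := fun h0 =>
      (b χ).orthonormal.ne_zero i (Subtype.ext h0)
    refine ⟨(χ none).re, ?_⟩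
    have hev : Module.End.HasEigenvalue f (χ none) :=
      Module.End.hasEigenvalue_of_hasEigenvector
        ⟨Module.End.mem_eigenspace_iff.2 h, hne⟩
    rw [Complex.conj_eq_iff_re.1 (hsymm.conj_eigenvalue_eq_self hev)]
    exact h

end IsUnitaryAction

end Commutant

/-! ### Essential self-adjointness from an orthonormal eigenbasis -/

section Unbounded

variable {E : Type*} [NormedAddCommGroup E] [InnerProductSpace ℂ E] [CompleteSpace E]

/-- A symmetric operator whose domain contains a Hilbert basis of eigenvectors with real
eigenvalues is essentially self-adjoint: an element of the graph of the adjoint is the limit of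
the graph elements over the partial sums of its Fourier series. -/
theorem isEssentiallySelfAdjoint_of_hilbertBasis {ι : Type*} (T : E →ₗ.[ℂ] E)
    (hsymm : T.IsFormalAdjoint T) (e : HilbertBasis ι ℂ E) (hdom : ∀ i, e i ∈ T.domain)
    (c : ι → ℝ) (hc : ∀ i, T ⟨e i, hdom i⟩ = (c i : ℂ) • e i) : IsEssentiallySelfAdjoint T := by
  have hdense : Dense (T.domain : Set E) := by
    have h1 : Submodule.span ℂ (Set.range e) ≤ T.domain :=
      Submodule.span_le.2 (by rintro _ ⟨i, rfl⟩; exact hdom i)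
    have h2 : Dense (Submodule.span ℂ (Set.range e) : Set E) := by
      rw [Submodule.dense_iff_topologicalClosure_eq_top]
      exact e.dense_span
    exact h2.mono h1
  have hle : T ≤ T.adjoint := hsymm.le_adjoint hdense
  have hclosed : T.adjoint.IsClosed := LinearPMap.adjoint_isClosed hdense
  have hclosable : T.IsClosable := hclosed.isClosable.leIsClosable hle
  have hadj : T.adjoint = T.closure := by
    refine le_antisymm (LinearPMap.le_of_le_graph ?_) ?_
    · rw [← hclosable.graph_closure_eq_closure_graph]
      rintro ⟨x, y⟩ hxy
      obtain ⟨z, rfl, rfl⟩ := (LinearPMap.mem_graph_iff _).1 hxy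
      have hcoef : ∀ i, e.repr (T.adjoint z) i = (c i : ℂ) * e.repr (z : E) i := by
        intro i
        have h := LinearPMap.adjoint_isFormalAdjoint hdense z ⟨e i, hdom i⟩
        rw [hc, inner_smul_right] at h
        rw [e.repr_apply_apply, e.repr_apply_apply, ← inner_conj_symm, h, map_mul,
          inner_conj_symm, Complex.conj_ofReal]
      have h1 := e.hasSum_repr (z : E)
      have h2 := e.hasSum_repr (T.adjoint z)
      have hlim := h1.prodMk_nhds h2
      refine mem_closure_of_tendsto hlim (Filter.Eventually.of_forall fun s => ?_)
      have hsum : ((∑ i ∈ s, e.repr (z : E) i • e i, ∑ i ∈ s, e.repr (T.adjoint z) i • e i) : E × E)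
          = ∑ i ∈ s, e.repr (z : E) i • ((e i, (c i : ℂ) • e i) : E × E) := by
        refine Prod.ext ?_ ?_
        · simp [Prod.fst_sum]
        · simp only [Prod.snd_sum, Prod.smul_mk, smul_smul]
          exact Finset.sum_congr rfl fun i _ => by rw [hcoef, mul_comm]
      change ((∑ i ∈ s, e.repr (z : E) i • e i, ∑ i ∈ s, e.repr (T.adjoint z) i • e i) : E × E)
        ∈ T.graph
      rw [hsum]
      refine Submodule.sum_mem _ fun i _ => Submodule.smul_mem _ _ ?_
      rw [← hc]
      exact T.mem_graph ⟨e i, hdom i⟩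
    · refine LinearPMap.le_of_le_graph ?_
      rw [← hclosable.graph_closure_eq_closure_graph]
      exact Submodule.topologicalClosure_minimal _ (LinearPMap.le_graph_of_le hle) hclosed
  have hdense' : Dense (T.closure.domain : Set E) := hdense.mono T.le_closure.1
  refine ⟨hdense, hclosable, LinearPMap.isSelfAdjoint_def.2 (le_antisymm ?_ ?_)⟩
  · -- an adjoint of the closure is an adjoint of `T`
    refine le_trans (LinearPMap.IsFormalAdjoint.le_adjoint hdense fun x y => ?_) hadj.le
    have h1 : (x : E) ∈ T.closure.domain := T.le_closure.1 x.2
    have h2 : T x = T.closure ⟨x, h1⟩ := T.le_closure.2 rfl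
    rw [h2]
    exact (LinearPMap.adjoint_isFormalAdjoint hdense').symm ⟨x, h1⟩ y
  · refine LinearPMap.IsFormalAdjoint.le_adjoint hdense' ?_
    -- the identity `⟪T x, y⟫ = ⟪x, T† y⟫` extends to the closure of the graph of `T`
    rintro x y
    have hmem : ((x : E), T.closure x) ∈ closure (T.graph : Set (E × E)) := by
      have := T.closure.mem_graph x
      rwa [← hclosable.graph_closure_eq_closure_graph] at this
    have hcl : IsClosed {p : E × E | ⟪p.2, (y : E)⟫_ℂ = ⟪p.1, T.closure y⟫_ℂ} :=
      isClosed_eq (by fun_prop) (by fun_prop)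
    refine closure_minimal (fun p hp => ?_) hcl hmem
    obtain ⟨z, h1, h2⟩ := (LinearPMap.mem_graph_iff _).1 hp
    have hformal := (LinearPMap.adjoint_isFormalAdjoint hdense).symm z
    rw [hadj] at hformal
    have := hformal y
    rwa [h1, h2] at this

end Unbounded

namespace HermitianSpace

variable {A H Ω : Type*} [Ring A] [HopfAlgebra ℂ A] [StarRing A] [StarModule ℂ A]
  [Ring H] [HopfAlgebra ℂ H] [StarRing H] [StarModule ℂ H] [Ring Ω] [Algebra ℂ Ω]
  (S : HermitianSpace A H Ω)

theorem toL2_coe (f : S.Forms →ₗ[ℂ] S.Forms) (x : S.Forms) (h : (x : S.L2) ∈ (S.toL2 f).domain) :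
    S.toL2 f ⟨x, h⟩ = ((f x : S.Forms) : S.L2) := by
  have : (LinearEquiv.ofInjective
      (UniformSpace.Completion.toComplₗᵢ (𝕜 := ℂ) (E := S.Forms)).toLinearMap
      (UniformSpace.Completion.toComplₗᵢ (𝕜 := ℂ) (E := S.Forms)).injective).symm ⟨x, h⟩ = x := by
    rw [LinearEquiv.symm_apply_eq]
    rfl
  change ((f _ : S.Forms) : S.L2) = _
  exact congrArg (fun z : S.Forms => ((f z : S.Forms) : S.L2)) this

theorem toL2_isFormalAdjoint {f : S.Forms →ₗ[ℂ] S.Forms} (hf : f.IsSymmetric) :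
    (S.toL2 f).IsFormalAdjoint (S.toL2 f) := by
  rintro ⟨_, x, rfl⟩ ⟨_, y, rfl⟩
  have h1 := S.toL2_coe f x ⟨x, rfl⟩
  have h2 := S.toL2_coe f y ⟨y, rfl⟩
  change ⟪S.toL2 f ⟨(x : S.L2), ⟨x, rfl⟩⟩, (y : S.L2)⟫_ℂ
    = ⟪(x : S.L2), S.toL2 f ⟨(y : S.L2), ⟨y, rfl⟩⟩⟫_ℂ
  rw [h1, h2, UniformSpace.Completion.inner_coe, UniformSpace.Completion.inner_coe, hf]

/-- An orthonormal family of eigenforms that spans `Ω^•` algebraically is a Hilbert basis of the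
completion. -/
theorem diagonalisable_and_essentiallySelfAdjoint {f : S.Forms →ₗ[ℂ] S.Forms} (hf : f.IsSymmetric)
    {w : Set S.Forms} (hw : Orthonormal ℂ ((↑) : w → S.Forms)) (hspan : Submodule.span ℂ w = ⊤)
    (heig : ∀ x ∈ w, ∃ c : ℝ, f x = (c : ℂ) • x) :
    IsDiagonalisable (S.toL2 f) ∧ IsEssentiallySelfAdjoint (S.toL2 f) := by
  let J := UniformSpace.Completion.toComplₗᵢ (𝕜 := ℂ) (E := S.Forms)
  have hon : Orthonormal ℂ ((↑) : Set.range (fun x : w => J x) → S.L2) :=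
    (hw.comp_linearIsometry J).toSubtypeRange
  have hdense : ⊤ ≤ (Submodule.span ℂ (Set.range
      ((↑) : Set.range (fun x : w => J x) → S.L2))).topologicalClosure := by
    have h1 : Set.range ((↑) : Set.range (fun x : w => J x) → S.L2) = J.toLinearMap '' w := by
      rw [Subtype.range_coe]
      ext z
      simp [J]
    rw [h1, ← Submodule.map_span, hspan, Submodule.map_top]
    rw [← Submodule.dense_iff_topologicalClosure_eq_top.1]
    exact UniformSpace.Completion.denseRange_coe
  let e := HilbertBasis.mk hon hdense
  have he : ∀ i, e i = (i : S.L2) := fun i => by rw [HilbertBasis.coe_mk]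
  have heig' : ∀ i : Set.range (fun x : w => J x), ∃ (hi : (i : S.L2) ∈ (S.toL2 f).domain) (c : ℝ),
      S.toL2 f ⟨i, hi⟩ = (c : ℂ) • (i : S.L2) := by
    rintro ⟨_, x, rfl⟩
    obtain ⟨c, hc⟩ := heig x x.2
    refine ⟨⟨x, rfl⟩, c, ?_⟩
    refine (S.toL2_coe f x ⟨x, rfl⟩).trans ?_
    rw [hc]
    exact UniformSpace.Completion.coe_smul _ _
  choose hdom c hc using heig'
  refine ⟨⟨_, e, he, fun i => ⟨hdom i, c i, hc i⟩⟩, ?_⟩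
  refine isEssentiallySelfAdjoint_of_hilbertBasis _ (S.toL2_isFormalAdjoint hf) e
    (fun i => by rw [he]; exact hdom i) c fun i => ?_
  simp only [he]
  exact hc i

end HermitianSpace

/-! ### The action of the dual algebra on a comodule -/

section Slice

variable {A M N : Type*} [AddCommGroup A] [Module ℂ A] [AddCommGroup M] [Module ℂ M]
  [AddCommGroup N] [Module ℂ N]

/-- The slice map `χ ⊗ id : A ⊗ M → M`. -/
def slice (χ : A →ₗ[ℂ] ℂ) : A ⊗[ℂ] M →ₗ[ℂ] M :=
  (TensorProduct.lid ℂ M).toLinearMap ∘ₗ χ.rTensor M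

@[simp]
theorem slice_tmul (χ : A →ₗ[ℂ] ℂ) (a : A) (m : M) : slice χ (a ⊗ₜ[ℂ] m) = χ a • m := by
  simp [slice]

theorem slice_lTensor (χ : A →ₗ[ℂ] ℂ) (f : M →ₗ[ℂ] N) (t : A ⊗[ℂ] M) :
    slice χ (f.lTensor A t) = f (slice χ t) := by
  induction t with
  | zero => simp
  | tmul a m => simp
  | add x y hx hy => rw [map_add, map_add, hx, hy, map_add, map_add]

/-- Slice maps separate the points of `A ⊗ M`. -/
theorem eq_zero_of_slice_eq_zero {t : A ⊗[ℂ] M} (h : ∀ χ : A →ₗ[ℂ] ℂ, slice χ t = 0) : t = 0 := by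
  let b := Module.Free.chooseBasis ℂ A
  have key : ∀ t : A ⊗[ℂ] M, ∀ i,
      TensorProduct.equivFinsuppOfBasisLeft b t i = slice (b.coord i) t := by
    intro t i
    induction t with
    | zero => simp
    | tmul a m => simp
    | add x y hx hy => rw [map_add, Finsupp.add_apply, hx, hy, map_add]
  apply (TensorProduct.equivFinsuppOfBasisLeft b).injective
  rw [map_zero]
  ext i
  rw [key, h, Finsupp.zero_apply]

theorem eq_of_slice_eq {t u : A ⊗[ℂ] M} (h : ∀ χ : A →ₗ[ℂ] ℂ, slice χ t = slice χ u) : t = u :=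
  sub_eq_zero.1 (eq_zero_of_slice_eq_zero fun χ => by rw [map_sub, h, sub_self])

end Slice

theorem proj_comm_of_mapsTo {ι R : Type*} [DecidableEq ι] [AddMonoid ι] [Ring R] [Algebra ℂ R]
    (𝒜 : ι → Submodule ℂ R) [GradedAlgebra 𝒜] {T : R →ₗ[ℂ] R} (hT : ∀ i, ∀ x ∈ 𝒜 i, T x ∈ 𝒜 i)
    (i : ι) (x : R) : GradedAlgebra.proj 𝒜 i (T x) = T (GradedAlgebra.proj 𝒜 i x) := by
  induction x using DirectSum.Decomposition.inductionOn 𝒜 with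
  | zero => simp
  | @homogeneous j m =>
    simp only [GradedAlgebra.proj_apply]
    by_cases hij : j = i
    · subst hij
      rw [DirectSum.decompose_of_mem_same 𝒜 (hT _ _ m.2), DirectSum.decompose_of_mem_same 𝒜 m.2]
    · rw [DirectSum.decompose_of_mem_ne 𝒜 (hT _ _ m.2) hij,
        DirectSum.decompose_of_mem_ne 𝒜 m.2 hij, map_zero]
  | add x y hx hy => rw [map_add, map_add, hx, hy, map_add, map_add]

/-- A linear map which preserves the bidegree and commutes with `d` commutes with the components
of `d`. -/
theorem ComplexStructure.shiftPart_comm {B Ω : Type*} [Ring B] [Algebra ℂ B] [StarRing B] [Ring Ω]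
    [Algebra ℂ Ω] {C : DiffStarCalculus B Ω} (K : ComplexStructure C) {T : Ω →ₗ[ℂ] Ω}
    (hT : ∀ p, ∀ x ∈ K.bideg p, T x ∈ K.bideg p) (hd : ∀ x, C.d (T x) = T (C.d x)) (s : ℕ × ℕ)
    (x : Ω) : K.shiftPart s (T x) = T (K.shiftPart s x) := by
  have hom : ∀ p, ∀ x ∈ K.bideg p,
      K.shiftPart s x = GradedAlgebra.proj K.bideg (p + s) (C.d x) := by
    intro p x hx
    simp only [shiftPart, LinearMap.comp_apply, LinearEquiv.coe_coe,
      DirectSum.decomposeLinearEquiv_apply]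
    rw [DirectSum.decompose_of_mem K.bideg hx]
    erw [DirectSum.toModule_lof]
    rfl
  induction x using DirectSum.Decomposition.inductionOn K.bideg with
  | zero => simp
  | @homogeneous p m =>
    rw [hom p _ (hT p _ m.2), hom p _ m.2, hd, proj_comm_of_mapsTo K.bideg hT]
  | add x y hx hy => rw [map_add, map_add, hx, hy, map_add, map_add]

namespace CovariantCalculus

variable {A H : Type*} [Ring A] [HopfAlgebra ℂ A] [StarRing A] [StarModule ℂ A]
  [Ring H] [HopfAlgebra ℂ H] [StarRing H] [StarModule ℂ H] {Q : HomogeneousSpace A H}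
  {Ω : Type*} [Ring Ω] [Algebra ℂ Ω] (C : CovariantCalculus Q Ω)

/-- The action of a functional `χ` on forms, `T_χ = (χ ⊗ id) Δ_L`. -/
def act (χ : A →ₗ[ℂ] ℂ) : Ω →ₗ[ℂ] Ω := slice χ ∘ₗ C.coact.toLinearMap

theorem act_apply (χ : A →ₗ[ℂ] ℂ) (ω : Ω) : C.act χ ω = slice χ (C.coact ω) := rfl

theorem act_counit (ω : Ω) : C.act (Coalgebra.counit (R := ℂ) (A := A)) ω = ω := C.counit ω

/-- The action turns the (opposite) convolution product into composition. -/
theorem act_act (χ ψ : A →ₗ[ℂ] ℂ) (ω : Ω) : C.act χ (C.act ψ ω) =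
    C.act ((TensorProduct.lid ℂ ℂ).toLinearMap ∘ₗ TensorProduct.map ψ χ ∘ₗ
      Coalgebra.comul (R := ℂ) (A := A)) ω := by
  have h1 : C.coact (C.act ψ ω) = slice ψ (TensorProduct.assoc ℂ A A Ω
      ((Coalgebra.comul (R := ℂ) (A := A)).rTensor Ω (C.coact ω))) := by
    rw [C.coassoc, slice_lTensor]
    rfl
  rw [act_apply, h1, act_apply]
  generalize C.coact ω = t
  induction t with
  | zero => simp
  | tmul a m =>
    rw [LinearMap.rTensor_tmul, slice_tmul, LinearMap.comp_apply, LinearMap.comp_apply]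
    generalize Coalgebra.comul (R := ℂ) a = u
    induction u with
    | zero => simp
    | tmul x y => simp [mul_smul]
    | add x y hx hy =>
      rw [TensorProduct.add_tmul, map_add, map_add, map_add, hx, hy, map_add, map_add, add_smul]
  | add x y hx hy => simp only [map_add, hx, hy]

theorem act_comm {f : Ω →ₗ[ℂ] Ω} (hf : ∀ ω, C.coact (f ω) = f.lTensor A (C.coact ω))
    (χ : A →ₗ[ℂ] ℂ) (ω : Ω) : f (C.act χ ω) = C.act χ (f ω) := by
  rw [act_apply, act_apply, hf, slice_lTensor]

theorem coact_of_act_comm {f : Ω →ₗ[ℂ] Ω} (hf : ∀ χ ω, f (C.act χ ω) = C.act χ (f ω)) (ω : Ω) :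
    C.coact (f ω) = f.lTensor A (C.coact ω) :=
  eq_of_slice_eq fun χ => by rw [slice_lTensor, ← act_apply, ← act_apply, hf]

theorem IsSubcomodule.act_mem {C : CovariantCalculus Q Ω} {V : Submodule ℂ Ω}
    (hV : C.IsSubcomodule V) (χ : A →ₗ[ℂ] ℂ) {ω : Ω} (hω : ω ∈ V) : C.act χ ω ∈ V := by
  obtain ⟨t, ht⟩ := hV ω hω
  rw [act_apply, ← ht, slice_lTensor]
  exact (slice χ t).2

theorem act_mul_of_coinvariant {σ : Ω} (hσ : C.coact σ = (1 : A) ⊗ₜ[ℂ] σ) (χ : A →ₗ[ℂ] ℂ) (ω : Ω) :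
    C.act χ (σ * ω) = σ * C.act χ ω := by
  rw [act_apply, act_apply, map_mul, hσ]
  generalize C.coact ω = t
  induction t with
  | zero => simp
  | tmul a m => simp
  | add x y hx hy => rw [mul_add, map_add, hx, hy, map_add, mul_add]

/-- The operators `T_χ` on a form span a finite-dimensional space. -/
theorem finite_range_act (ω : Ω) :
    FiniteDimensional ℂ (Submodule.span ℂ (Set.range fun χ : A →ₗ[ℂ] ℂ => C.act χ ω)) := by
  suffices h : ∀ t : A ⊗[ℂ] Ω, ∃ X : Submodule ℂ Ω, FiniteDimensional ℂ X ∧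
      ∀ χ : A →ₗ[ℂ] ℂ, slice χ t ∈ X by
    obtain ⟨X, hX, h⟩ := h (C.coact ω)
    exact Submodule.finiteDimensional_of_le (Submodule.span_le.2 (by rintro _ ⟨χ, rfl⟩; exact h χ))
  intro t
  induction t with
  | zero => exact ⟨⊥, inferInstance, fun χ => by simp⟩
  | tmul a m =>
    exact ⟨Submodule.span ℂ {m}, inferInstance, fun χ => by
      rw [slice_tmul]
      exact Submodule.smul_mem _ _ (Submodule.mem_span_singleton_self m)⟩
  | add x y hx hy =>
    obtain ⟨X, hX, h⟩ := hx
    obtain ⟨Y, hY, h'⟩ := hy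
    exact ⟨X ⊔ Y, inferInstance, fun χ => by
      rw [map_add]
      exact Submodule.add_mem_sup (h χ) (h' χ)⟩

end CovariantCalculus

/-! ### The Lefschetz decomposition -/

namespace HermitianStructure

variable {B Ω : Type*} [Ring B] [Algebra ℂ B] [StarRing B] [Ring Ω] [Algebra ℂ Ω]
  {C : DiffStarCalculus B Ω} (K : HermitianStructure C)

theorem L_pow_apply (m : ℕ) (ω : Ω) : (K.L ^ m) ω = K.σ ^ m * ω := by
  rw [L, LinearMap.pow_mulLeft, LinearMap.mulLeft_apply]

theorem bideg_le_deg (p : ℕ × ℕ) : K.bideg p ≤ C.deg (p.1 + p.2) := by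
  rw [K.deg_eq]
  exact le_iSup₂_of_le p rfl le_rfl

theorem L_pow_mem_deg (m : ℕ) {k : ℕ} {ω : Ω} (hω : ω ∈ C.deg k) :
    (K.L ^ m) ω ∈ C.deg (2 * m + k) := by
  rw [L_pow_apply]
  have h := SetLike.pow_mem_graded (A := C.deg) m (K.bideg_le_deg _ K.σ_mem)
  have := SetLike.mul_mem_graded (A := C.deg) h hω
  convert this using 2
  simp [mul_comm]

/-- Operators commuting with `L` and preserving the bidegree preserve primitive forms. -/
theorem map_mem_primitive {T : Ω →ₗ[ℂ] Ω} (hT : ∀ p, ∀ x ∈ K.bideg p, T x ∈ K.bideg p)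
    (hL : ∀ m x, T ((K.L ^ m) x) = (K.L ^ m) (T x)) {a b : ℕ} {x : Ω} (hx : x ∈ K.primitive a b) :
    T x ∈ K.primitive a b := by
  unfold primitive at *
  split_ifs at * with h
  · refine ⟨hT _ _ hx.1, LinearMap.mem_ker.2 ?_⟩
    rw [← hL, LinearMap.mem_ker.1 hx.2, map_zero]
  · rw [(Submodule.mem_bot ℂ).1 hx, map_zero]
    exact Submodule.zero_mem _

/-- The span of the forms `L^j ω` with `ω` primitive of degree `k` and `j ≤ n - k`. -/
def lefschetzSpan : Submodule ℂ Ω :=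
  Submodule.span ℂ {ω | ∃ a b j : ℕ, a + b + j ≤ K.n ∧ ∃ η ∈ K.primitive a b, ω = (K.L ^ j) η}

theorem proj_bideg_eq_zero {k : ℕ} {ω : Ω} (hω : ω ∈ C.deg k) {p : ℕ × ℕ} (hp : p.1 + p.2 ≠ k) :
    GradedAlgebra.proj K.bideg p ω = 0 := by
  have hle : C.deg k ≤ LinearMap.ker (GradedAlgebra.proj K.bideg p) := by
    rw [K.deg_eq]
    refine iSup₂_le fun q hq x hx => LinearMap.mem_ker.2 ?_
    rw [GradedAlgebra.proj_apply, DirectSum.decompose_of_mem_ne K.bideg hx]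
    rintro rfl
    exact hp hq
  exact LinearMap.mem_ker.1 (hle hω)

theorem L_pow_proj (m : ℕ) (p : ℕ × ℕ) (ω : Ω) :
    (K.L ^ m) (GradedAlgebra.proj K.bideg p ω) =
      GradedAlgebra.proj K.bideg (m • (1, 1) + p) ((K.L ^ m) ω) := by
  rw [L_pow_apply, L_pow_apply, GradedAlgebra.proj_apply, GradedAlgebra.proj_apply,
    DirectSum.coe_decompose_mul_add_of_left_mem K.bideg (SetLike.pow_mem_graded m K.σ_mem)]

/-- Since `L` is bihomogeneous, the bihomogeneous components of a primitive form are primitive. -/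
theorem L_pow_mem_lefschetzSpan_of_ker {k m : ℕ} (hmk : k + m ≤ K.n) {ω : Ω} (hω : ω ∈ C.deg k)
    (hker : (K.L ^ (K.n - k + 1)) ω = 0) : (K.L ^ m) ω ∈ K.lefschetzSpan := by
  classical
  rw [← DirectSum.sum_support_decompose K.bideg ω, map_sum]
  refine Submodule.sum_mem _ fun p _ => ?_
  rw [← GradedAlgebra.proj_apply]
  by_cases hp : p.1 + p.2 = k
  · refine Submodule.subset_span ⟨p.1, p.2, m, by omega, _, ?_, rfl⟩
    rw [primitive, if_pos (by omega)]
    refine ⟨SetLike.coe_mem _, LinearMap.mem_ker.2 ?_⟩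
    rw [hp, L_pow_proj, hker, map_zero]
  · rw [K.proj_bideg_eq_zero hω hp, map_zero]
    exact Submodule.zero_mem _

theorem L_pow_mem_lefschetzSpan (k : ℕ) : ∀ m, k + m ≤ K.n → ∀ ω ∈ C.deg k,
    (K.L ^ m) ω ∈ K.lefschetzSpan := by
  induction k using Nat.strong_induction_on with
  | _ k ih =>
  intro m hm ω hω
  have hdeg := K.L_pow_mem_deg (K.n - k + 1) hω
  obtain hk | ⟨l, rfl⟩ : k < 2 ∨ ∃ l, k = l + 2 := by
    rcases Nat.lt_or_ge k 2 with h | h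
    · exact Or.inl h
    · exact Or.inr ⟨k - 2, by omega⟩
  · refine K.L_pow_mem_lefschetzSpan_of_ker hm hω ?_
    rw [K.totalDegree.2 _ (by omega)] at hdeg
    exact (Submodule.mem_bot ℂ).1 hdeg
  · -- subtract from `ω` the form `L η` with `L^{n-k+2} η = L^{n-k+1} ω`
    rw [show 2 * (K.n - (l + 2) + 1) + (l + 2) = 2 * K.n - l by omega] at hdeg
    obtain ⟨η, hη, hηω⟩ := (K.lefschetz l (by omega)).surjOn hdeg
    change (K.L ^ (K.n - l)) η = _ at hηω
    have hLη : (K.L ^ 1) η ∈ C.deg (l + 2) := by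
      have := K.L_pow_mem_deg 1 hη
      rwa [show 2 * 1 + l = l + 2 by omega] at this
    have h1 := K.L_pow_mem_lefschetzSpan_of_ker hm (Submodule.sub_mem _ hω hLη) (by
      rw [map_sub, ← Module.End.mul_apply, ← pow_add,
        show K.n - (l + 2) + 1 + 1 = K.n - l by omega, hηω, sub_self])
    have h2 := ih l (by omega) (m + 1) (by omega) η hη
    rw [map_sub, ← Module.End.mul_apply, ← pow_add] at h1
    have := Submodule.add_mem _ h1 h2
    rwa [sub_add_cancel] at this

/-- Every form is a sum of forms `L^j ω` with `ω` primitive. -/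
theorem lefschetzSpan_eq_top : K.lefschetzSpan = ⊤ := by
  classical
  rw [eq_top_iff]
  rintro ω -
  rw [← DirectSum.sum_support_decompose C.deg ω]
  refine Submodule.sum_mem _ fun k _ => ?_
  have hx := SetLike.coe_mem (DirectSum.decompose C.deg ω k)
  generalize ((DirectSum.decompose C.deg ω k : C.deg k) : Ω) = x at hx ⊢
  rcases le_or_gt k K.n with hk | hk
  · exact K.L_pow_mem_lefschetzSpan k 0 hk x hx
  rcases le_or_gt k (2 * K.n) with hk' | hk'
  · rw [show k = 2 * K.n - (2 * K.n - k) by omega] at hx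
    obtain ⟨η, hη, hηx⟩ := (K.lefschetz (2 * K.n - k) (by omega)).surjOn hx
    rw [← hηx]
    exact K.L_pow_mem_lefschetzSpan _ _ (by omega) η hη
  · rw [K.totalDegree.2 k hk'] at hx
    rw [(Submodule.mem_bot ℂ).1 hx]
    exact Submodule.zero_mem _

/-- The Hodge map commutes with the operators that preserve the bidegree and commute with `L`. -/
theorem IsHodgeMap.comm {K : HermitianStructure C} {S : Ω →ₗ[ℂ] Ω} (hS : K.IsHodgeMap S)
    {T : Ω →ₗ[ℂ] Ω} (hT : ∀ p, ∀ x ∈ K.bideg p, T x ∈ K.bideg p)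
    (hL : ∀ m x, T ((K.L ^ m) x) = (K.L ^ m) (T x)) (x : Ω) : S (T x) = T (S x) := by
  have hx : x ∈ K.lefschetzSpan := by rw [lefschetzSpan_eq_top]; trivial
  induction hx using Submodule.span_induction with
  | mem x hx =>
    obtain ⟨a, b, j, hj, η, hη, rfl⟩ := hx
    rw [hL, hS a b j hj _ (K.map_mem_primitive hT hL hη), hS a b j hj η hη, map_smul, hL]
  | zero => simp
  | add x y _ _ hx hy => rw [map_add, map_add, hx, hy, map_add, map_add]
  | smul c x _ hx => rw [map_smul, map_smul, hx, map_smul, map_smul]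

/-- Positivity of the metric forces the Hodge map to exist: otherwise `hodge`, and with it the
metric, would be `0`, whereas `Ω^{2n} ≠ 0`. -/
theorem IsPositive.isHodgeMap_hodge {K : HermitianStructure C} (hK : K.IsPositive) :
    K.IsHodgeMap K.hodge := by
  obtain ⟨ω, -, hω⟩ := (Submodule.ne_bot_iff _).1 K.totalDegree.1
  by_cases h : ∃ T : Ω →ₗ[ℂ] Ω, K.IsHodgeMap T
  · rw [hodge, dif_pos h]
    exact h.choose_spec
  · refine absurd ?_ (hK ω hω).1
    simp [metric, hodge, dif_neg h]

end HermitianStructure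

/-! ### Covariance of the involution -/

namespace HomogeneousSpace

variable {A H : Type*} [Ring A] [HopfAlgebra ℂ A] [StarRing A] [StarModule ℂ A]
  [Ring H] [HopfAlgebra ℂ H] [StarRing H] [StarModule ℂ H]

theorem leftCoaction_star (Q : HomogeneousSpace A H) (b : Q.coinv) :
    Q.leftCoaction (star b) = star (Q.leftCoaction b) := by
  apply Q.inclLin_injective
  have h : ∀ t : A ⊗[ℂ] Q.coinv, Q.inclLin.lTensor A (star t) = star (Q.inclLin.lTensor A t) := by
    intro t
    induction t with
    | zero => simp
    | tmul x y => simp only [TensorProduct.star_tmul, LinearMap.lTensor_tmul]; rfl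
    | add x y hx hy => rw [star_add, map_add, hx, hy, map_add, star_add]
  rw [h, Q.lTensor_leftCoaction, Q.lTensor_leftCoaction, ← Q.isCQGA_left.comul_star]
  rfl

end HomogeneousSpace

namespace CovariantCalculus

variable {A H : Type*} [Ring A] [HopfAlgebra ℂ A] [StarRing A] [StarModule ℂ A]
  [Ring H] [HopfAlgebra ℂ H] [StarRing H] [StarModule ℂ H] {Q : HomogeneousSpace A H}
  {Ω : Type*} [Ring Ω] [Algebra ℂ Ω] (C : CovariantCalculus Q Ω)

/-- The map `a ⊗ ω ↦ a* ⊗ M(ω)`, for a conjugate linear map `M`. -/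
def starTensor (M : Ω →ₗ⋆[ℂ] Ω) : A ⊗[ℂ] Ω →ₗ⋆[ℂ] A ⊗[ℂ] Ω :=
  TensorProduct.map (starLinearEquiv ℂ : A ≃ₗ⋆[ℂ] A).toLinearMap M

@[simp]
theorem starTensor_tmul (M : Ω →ₗ⋆[ℂ] Ω) (a : A) (ω : Ω) :
    starTensor M (a ⊗ₜ[ℂ] ω) = star a ⊗ₜ[ℂ] M ω := rfl

theorem starTensor_lTensor (M : Ω →ₗ⋆[ℂ] Ω) (f g : Ω →ₗ[ℂ] Ω) (t : A ⊗[ℂ] Ω) :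
    f.lTensor A (starTensor M (g.lTensor A t)) =
      starTensor (f.comp (M.comp g)) t := by
  induction t with
  | zero => simp
  | tmul a m => simp
  | add x y hx hy => simp only [map_add, hx, hy]

variable {C} in
theorem isSubcomodule_iSup {ι : Sort*} {V : ι → Submodule ℂ Ω} (hV : ∀ i, C.IsSubcomodule (V i)) :
    C.IsSubcomodule (⨆ i, V i) := by
  have hle : ⨆ i, V i ≤ (LinearMap.range ((⨆ i, V i).subtype.lTensor A)).comap
      C.coact.toLinearMap := by
    refine iSup_le fun i x hx => ?_
    obtain ⟨t, ht⟩ := hV i x hx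
    refine ⟨(Submodule.inclusion (le_iSup V i)).lTensor A t, ?_⟩
    rw [← LinearMap.comp_apply, ← LinearMap.lTensor_comp, Submodule.subtype_comp_inclusion]
    exact ht
  exact fun ω hω => hle hω

/-- The coaction intertwines the involutions: it suffices to check this on the generators `b` and
`d b`, and both sides are graded antimultiplicative on homogeneous forms. -/
theorem coact_conj (hdeg : ∀ k, C.IsSubcomodule (C.deg k)) (ω : Ω) :
    C.coact (C.conj ω) = starTensor C.conj (C.coact ω) := by
  classical
  let P : Submodule ℂ Ω :=
    { carrier := {ω | C.coact (C.conj ω) = starTensor C.conj (C.coact ω)}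
      add_mem' := fun {x y} hx hy => by
        simp only [Set.mem_ofPred_eq, map_add] at *
        rw [hx, hy]
      zero_mem' := by simp
      smul_mem' := fun c x hx => by
        simp only [Set.mem_ofPred_eq, LinearMap.map_smulₛₗ, map_smul] at *
        rw [hx] }
  have hP : ∀ ω, ω ∈ P ↔ C.coact (C.conj ω) = starTensor C.conj (C.coact ω) := fun _ => Iff.rfl
  have hincl : ∀ b, C.incl b ∈ P := by
    intro b
    rw [hP, C.conj_incl, C.coact_incl, C.coact_incl, Q.leftCoaction_star]
    generalize Q.leftCoaction b = t
    induction t with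
    | zero => simp
    | tmul a b =>
      rw [TensorProduct.star_tmul, LinearMap.lTensor_tmul, LinearMap.lTensor_tmul,
        starTensor_tmul]
      exact congrArg (star a ⊗ₜ[ℂ] ·) (C.conj_incl b).symm
    | add x y hx hy => rw [star_add, map_add, hx, hy, map_add, map_add]
  have hd : ∀ ω ∈ P, C.d ω ∈ P := by
    intro ω hω
    rw [hP] at hω ⊢
    rw [C.conj_d, C.coact_d, hω, C.coact_d]
    generalize C.coact ω = t
    induction t with
    | zero => simp
    | tmul a x => simp [C.conj_d]
    | add x y hx hy => simp only [map_add, hx, hy]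
  have hmul : ∀ k l, ∀ x ∈ C.deg k, ∀ y ∈ C.deg l, x ∈ P → y ∈ P → x * y ∈ P := by
    intro k l x hx y hy hxP hyP
    rw [hP] at *
    rw [C.conj_mul k l x hx y hy, map_smul, map_mul, hxP, hyP, map_mul]
    obtain ⟨t, ht⟩ := hdeg k x hx
    obtain ⟨u, hu⟩ := hdeg l y hy
    rw [← ht, ← hu]
    clear ht hu
    induction t with
    | zero => simp
    | tmul a x =>
      induction u with
      | zero => simp
      | tmul b y => simp [C.conj_mul k l x x.2 y y.2]
      | add x y hx hy => simp only [map_add, add_mul, mul_add, hx, hy, smul_add]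
    | add x y hx hy => simp only [map_add, add_mul, mul_add, hx, hy, smul_add]
  have hgen : ∀ k, GradedAlgebra.proj C.deg k ω ∈ P := by
    have hω : ω ∈ Algebra.adjoin ℂ (Set.range C.incl ∪ Set.range (fun b => C.d (C.incl b))) := by
      rw [C.generated]; trivial
    have hhom : ∀ l, ∀ x ∈ C.deg l, x ∈ P → ∀ k, GradedAlgebra.proj C.deg k x ∈ P := by
      intro l x hx hxP k
      rw [GradedAlgebra.proj_apply, DirectSum.decompose_of_mem C.deg hx]
      by_cases h : l = k
      · subst h
        simpa using hxP
      · rw [DirectSum.of_eq_of_ne _ _ _ (Ne.symm h)]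
        exact P.zero_mem
    have hincl0 : ∀ b, C.incl b ∈ C.deg 0 := fun b => by
      rw [← C.range_incl]
      exact ⟨b, rfl⟩
    induction hω using Algebra.adjoin_induction with
    | mem x hx =>
      rcases hx with ⟨b, rfl⟩ | ⟨b, rfl⟩
      · exact hhom 0 _ (hincl0 b) (hincl b)
      · exact hhom 1 _ (C.d_mem 0 _ (hincl0 b)) (hd _ (hincl b))
    | algebraMap r =>
      rw [← C.incl.commutes r]
      exact hhom 0 _ (hincl0 _) (hincl _)
    | add x y _ _ hx hy => exact fun k => by rw [map_add]; exact P.add_mem (hx k) (hy k)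
    | mul x y _ _ hx hy =>
      intro k
      rw [← DirectSum.sum_support_decompose C.deg x, ← DirectSum.sum_support_decompose C.deg y,
        Finset.sum_mul_sum, map_sum]
      refine P.sum_mem fun i _ => ?_
      rw [map_sum]
      refine P.sum_mem fun j _ => ?_
      exact hhom (i + j) _ (SetLike.mul_mem_graded (SetLike.coe_mem _) (SetLike.coe_mem _))
        (hmul i j _ (SetLike.coe_mem _) _ (SetLike.coe_mem _) (hx i) (hy j)) k
  rw [← hP, ← DirectSum.sum_support_decompose C.deg ω]
  exact P.sum_mem fun k _ => hgen k

theorem rTensor_counit_coact (ω : Ω) :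
    (Algebra.linearMap ℂ A ∘ₗ Coalgebra.counit).rTensor Ω (C.coact ω) = (1 : A) ⊗ₜ[ℂ] ω := by
  have h : ∀ t : A ⊗[ℂ] Ω, (Algebra.linearMap ℂ A ∘ₗ Coalgebra.counit).rTensor Ω t =
      (1 : A) ⊗ₜ[ℂ] slice (Coalgebra.counit (R := ℂ) (A := A)) t := by
    intro t
    induction t with
    | zero => simp
    | tmul a x => simp [Algebra.algebraMap_eq_smul_one, TensorProduct.smul_tmul]
    | add x y hx hy => rw [map_add, hx, hy, map_add, TensorProduct.tmul_add]
  rw [h]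
  exact congrArg _ (C.act_counit ω)

/-- The identity `S(ω₍₋₂₎) ω₍₋₁₎ ⊗ ω₍₀₎ = 1 ⊗ ω`. -/
theorem lift_antipode_coact (ω : Ω) :
    TensorProduct.lift ((LinearMap.mul ℂ (A ⊗[ℂ] Ω)).compl₁₂
      ((Algebra.TensorProduct.includeLeft (R := ℂ) (S := ℂ) (A := A) (B := Ω)).toLinearMap ∘ₗ
        HopfAlgebra.antipode ℂ) C.coact.toLinearMap) (C.coact ω) = (1 : A) ⊗ₜ[ℂ] ω := by
  have h1 : ∀ t : A ⊗[ℂ] Ω, TensorProduct.lift ((LinearMap.mul ℂ (A ⊗[ℂ] Ω)).compl₁₂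
      ((Algebra.TensorProduct.includeLeft (R := ℂ) (S := ℂ) (A := A) (B := Ω)).toLinearMap ∘ₗ
        HopfAlgebra.antipode ℂ) C.coact.toLinearMap) t =
      (LinearMap.mul' ℂ A ∘ₗ (HopfAlgebra.antipode ℂ).rTensor A).rTensor Ω
        ((TensorProduct.assoc ℂ A A Ω).symm (C.coact.toLinearMap.lTensor A t)) := by
    intro t
    induction t with
    | zero => simp
    | tmul a x =>
      rw [TensorProduct.lift.tmul, LinearMap.lTensor_tmul]
      simp only [LinearMap.compl₁₂_apply, LinearMap.comp_apply, AlgHom.toLinearMap_apply,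
        LinearMap.mul_apply', Algebra.TensorProduct.includeLeft_apply]
      generalize C.coact x = u
      induction u with
      | zero => simp
      | tmul b y => simp
      | add x y hx hy => rw [mul_add, hx, hy, TensorProduct.tmul_add, map_add, map_add]
    | add x y hx hy => rw [map_add, hx, hy, map_add, map_add, map_add]
  rw [h1, ← C.coassoc, LinearEquiv.symm_apply_apply, ← LinearMap.comp_apply,
    ← LinearMap.rTensor_comp, LinearMap.comp_assoc, HopfAlgebra.mul_antipode_rTensor_comul]
  exact C.rTensor_counit_coact ω

end CovariantCalculus

/-! ### Invariance of the inner product -/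

namespace HermitianSpace

variable {A H Ω : Type*} [Ring A] [HopfAlgebra ℂ A] [StarRing A] [StarModule ℂ A]
  [Ring H] [HopfAlgebra ℂ H] [StarRing H] [StarModule ℂ H] [Ring Ω] [Algebra ℂ Ω]
  (S : HermitianSpace A H Ω)

theorem act_mem_bideg (χ : A →ₗ[ℂ] ℂ) (p : ℕ × ℕ) (ω : Ω) (hω : ω ∈ S.K.bideg p) :
    S.C.act χ ω ∈ S.K.bideg p :=
  (S.covariant_bideg p).act_mem χ hω

theorem isSubcomodule_deg (k : ℕ) : S.C.IsSubcomodule (S.C.deg k) := by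
  rw [S.K.deg_eq]
  exact CovariantCalculus.isSubcomodule_iSup fun p =>
    CovariantCalculus.isSubcomodule_iSup fun _ => S.covariant_bideg p

theorem act_L_pow (χ : A →ₗ[ℂ] ℂ) (m : ℕ) (ω : Ω) :
    S.C.act χ ((S.K.L ^ m) ω) = (S.K.L ^ m) (S.C.act χ ω) := by
  induction m with
  | zero => rfl
  | succ m ih =>
    rw [pow_succ', Module.End.mul_apply, Module.End.mul_apply, ← ih]
    exact S.C.act_mul_of_coinvariant S.covariant_σ χ _

theorem act_hodge (χ : A →ₗ[ℂ] ℂ) (ω : Ω) :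
    S.K.hodge (S.C.act χ ω) = S.C.act χ (S.K.hodge ω) :=
  S.positive.isHodgeMap_hodge.comm (S.act_mem_bideg χ) (S.act_L_pow χ) ω

theorem act_proj (k : ℕ) (χ : A →ₗ[ℂ] ℂ) (ω : Ω) :
    S.C.proj k (S.C.act χ ω) = S.C.act χ (S.C.proj k ω) :=
  proj_comm_of_mapsTo S.C.deg (fun k _ hω => (S.isSubcomodule_deg k).act_mem χ hω) k ω

theorem act_d (χ : A →ₗ[ℂ] ℂ) (ω : Ω) : S.C.d (S.C.act χ ω) = S.C.act χ (S.C.d ω) :=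
  S.C.act_comm S.C.coact_d χ ω

theorem act_shiftPart (s : ℕ × ℕ) (χ : A →ₗ[ℂ] ℂ) (ω : Ω) :
    S.K.shiftPart s (S.C.act χ ω) = S.C.act χ (S.K.shiftPart s ω) :=
  S.K.shiftPart_comm (S.act_mem_bideg χ) (S.act_d χ) s ω

/-- The integral `∫ = haar ∘ ∗_σ`, extended by `0` to forms not of top degree. -/
def integral : Ω →ₗ[ℂ] ℂ :=
  S.Q.isCQGA_left.haar ∘ₗ S.Q.inclLin ∘ₗ S.C.degZero ∘ₗ S.K.hodge

theorem inclLin_degZero_act (χ : A →ₗ[ℂ] ℂ) (ω : Ω) :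
    S.Q.inclLin (S.C.degZero (S.C.act χ ω)) =
      slice χ (Coalgebra.comul (R := ℂ) (S.Q.inclLin (S.C.degZero ω))) := by
  have h : S.C.degZero (S.C.act χ ω) = slice χ (S.Q.leftCoaction (S.C.degZero ω)) := by
    apply S.C.incl_injective
    rw [S.C.incl_degZero, S.act_proj, ← S.C.incl_degZero, S.C.act_apply, S.C.coact_incl,
      slice_lTensor]
    rfl
  rw [h, ← slice_lTensor, S.Q.lTensor_leftCoaction]
  rfl

/-- Invariance of the integral, from the invariance of the Haar functional. -/
theorem integral_act (χ : A →ₗ[ℂ] ℂ) (ω : Ω) : S.integral (S.C.act χ ω) = χ 1 * S.integral ω := by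
  simp only [integral, LinearMap.comp_apply]
  rw [S.act_hodge, S.inclLin_degZero_act]
  generalize S.Q.inclLin (S.C.degZero (S.K.hodge ω)) = a
  have h1 := congrArg χ (S.Q.isCQGA_left.isHaarFunctional_haar.right_inv a)
  rw [map_smul, smul_eq_mul, mul_comm] at h1
  rw [← h1]
  generalize Coalgebra.comul (R := ℂ) a = t
  induction t with
  | zero => simp
  | tmul x y => simp [mul_comm]
  | add x y hx hy => simp only [map_add, hx, hy]

theorem lTensor_integral_coact (ω : Ω) :
    S.integral.lTensor A (S.C.coact ω) = (1 : A) ⊗ₜ[ℂ] S.integral ω :=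
  eq_of_slice_eq fun χ => by
    rw [slice_lTensor, ← S.C.act_apply, S.integral_act, slice_tmul, smul_eq_mul]

/-- The conjugate linear map `ν ↦ ∗(ν*)` on `Ωᵏ`, extended by `0`. -/
def hodgeConj (k : ℕ) : Ω →ₗ⋆[ℂ] Ω := S.K.hodge.comp (S.C.conj.comp (S.C.proj k))

theorem coact_hodgeConj (k : ℕ) (ω : Ω) :
    S.C.coact (S.hodgeConj k ω) = CovariantCalculus.starTensor (S.hodgeConj k) (S.C.coact ω) := by
  simp only [hodgeConj, LinearMap.comp_apply]
  rw [S.C.coact_of_act_comm S.act_hodge, S.C.coact_conj S.isSubcomodule_deg,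
    S.C.coact_of_act_comm (S.act_proj k), CovariantCalculus.starTensor_lTensor]

theorem pairing_eq_sum (ω ν : Ω) : S.pairing ω ν =
    ∑ k ∈ Finset.range (2 * S.K.n + 1), S.integral (S.C.proj k ω * S.hodgeConj k ν) := by
  simp only [pairing, HermitianStructure.metric, map_sum]
  rfl

/-- The `A`-valued extension `(a ⊗ ω, b ⊗ ν) ↦ ⟨ω, ν⟩ a b*` of the inner product to `A ⊗ Ω`. -/
def pairingA (x y : A ⊗[ℂ] Ω) : A :=
  ∑ k ∈ Finset.range (2 * S.K.n + 1), TensorProduct.rid ℂ A (S.integral.lTensor A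
    ((S.C.proj k).lTensor A x * CovariantCalculus.starTensor (S.hodgeConj k) y))

theorem pairingA_add_left (x x' y : A ⊗[ℂ] Ω) :
    S.pairingA (x + x') y = S.pairingA x y + S.pairingA x' y := by
  simp [pairingA, add_mul, Finset.sum_add_distrib]

theorem pairingA_add_right (x y y' : A ⊗[ℂ] Ω) :
    S.pairingA x (y + y') = S.pairingA x y + S.pairingA x y' := by
  simp [pairingA, mul_add, Finset.sum_add_distrib]

@[simp]
theorem pairingA_zero_left (y : A ⊗[ℂ] Ω) : S.pairingA 0 y = 0 := by simp [pairingA]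

@[simp]
theorem pairingA_zero_right (x : A ⊗[ℂ] Ω) : S.pairingA x 0 = 0 := by simp [pairingA]

theorem pairingA_tmul_tmul (a b : A) (ω ν : Ω) :
    S.pairingA (a ⊗ₜ[ℂ] ω) (b ⊗ₜ[ℂ] ν) = S.pairing ω ν • (a * star b) := by
  rw [pairing_eq_sum, pairingA, Finset.sum_smul]
  refine Finset.sum_congr rfl fun k _ => ?_
  simp

/-- Invariance of the inner product: `⟨ω₍₀₎, ν₍₀₎⟩ ω₍₋₁₎ ν₍₋₁₎* = ⟨ω, ν⟩ 1`. -/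
theorem pairingA_coact_coact (ω ν : Ω) :
    S.pairingA (S.C.coact ω) (S.C.coact ν) = S.pairing ω ν • (1 : A) := by
  rw [pairing_eq_sum, pairingA, Finset.sum_smul]
  refine Finset.sum_congr rfl fun k _ => ?_
  rw [← S.C.coact_of_act_comm (S.act_proj k), ← S.coact_hodgeConj, ← map_mul,
    S.lTensor_integral_coact, TensorProduct.rid_tmul]

theorem pairingA_mul_right (x : A ⊗[ℂ] Ω) (c : A) (y : A ⊗[ℂ] Ω) :
    S.pairingA x ((c ⊗ₜ[ℂ] (1 : Ω)) * y) = S.pairingA x y * star c := by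
  induction y with
  | zero => simp
  | tmul b ν =>
    induction x with
    | zero => simp
    | tmul a ω => simp [pairingA_tmul_tmul, mul_assoc]
    | add x x' hx hx' => rw [pairingA_add_left, hx, hx', pairingA_add_left, add_mul]
  | add y y' hy hy' => rw [mul_add, pairingA_add_right, hy, hy', pairingA_add_right, add_mul]

theorem map_pairingA_one_tmul (χ : A →ₗ[ℂ] ℂ) (x : A ⊗[ℂ] Ω) (ν : Ω) :
    χ (S.pairingA x ((1 : A) ⊗ₜ[ℂ] ν)) = S.pairing (slice χ x) ν := by
  induction x with
  | zero => simpa using (S.pairing_smul_left 0 0 ν).symm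
  | tmul a ω => simp [pairingA_tmul_tmul, pairing_smul_left, mul_comm]
  | add x y hx hy => rw [pairingA_add_left, map_add, hx, hy, map_add, pairing_add_left]

end HermitianSpace

section DualStar

variable {A : Type*} [Ring A] [HopfAlgebra ℂ A] [StarRing A] [StarModule ℂ A]

/-- The functional `χ†(a) = conj χ(S(a)*)`. -/
def dualStar (χ : A →ₗ[ℂ] ℂ) : A →ₗ[ℂ] ℂ :=
  (starLinearEquiv ℂ : ℂ ≃ₗ⋆[ℂ] ℂ).toLinearMap.comp
    (χ.comp ((starLinearEquiv ℂ : A ≃ₗ⋆[ℂ] A).toLinearMap.comp (HopfAlgebra.antipode ℂ)))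

theorem dualStar_apply (χ : A →ₗ[ℂ] ℂ) (a : A) :
    dualStar χ a = starRingEnd ℂ (χ (star (HopfAlgebra.antipode ℂ a))) := rfl

end DualStar

namespace HermitianSpace

variable {A H Ω : Type*} [Ring A] [HopfAlgebra ℂ A] [StarRing A] [StarModule ℂ A]
  [Ring H] [HopfAlgebra ℂ H] [StarRing H] [StarModule ℂ H] [Ring Ω] [Algebra ℂ Ω]
  (S : HermitianSpace A H Ω)

/-- The adjoint of `T_χ` is `T_{χ†}`: the comodule `Ω^•` is unitary. -/
theorem pairing_act_left (χ : A →ₗ[ℂ] ℂ) (ω ν : Ω) :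
    S.pairing (S.C.act χ ω) ν = S.pairing ω (S.C.act (dualStar χ) ν) := by
  rw [S.C.act_apply, ← S.map_pairingA_one_tmul, ← S.C.lift_antipode_coact, S.C.act_apply]
  generalize S.C.coact ν = t
  induction t with
  | zero => simpa using (S.pairing_smul_right 0 ω 0).symm
  | tmul a ν =>
    rw [TensorProduct.lift.tmul]
    simp only [LinearMap.compl₁₂_apply, LinearMap.comp_apply, AlgHom.toLinearMap_apply,
      LinearMap.mul_apply', Algebra.TensorProduct.includeLeft_apply]
    rw [S.pairingA_mul_right, S.pairingA_coact_coact, smul_mul_assoc, one_mul, map_smul,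
      slice_tmul, pairing_smul_right, dualStar_apply, Complex.conj_conj, smul_eq_mul, mul_comm]
  | add x y hx hy => rw [map_add, pairingA_add_right, map_add, hx, hy, map_add, pairing_add_right]

end HermitianSpace

/-! ### The conditional expectation `A → B` -/

namespace HomogeneousSpace

variable {A H : Type*} [Ring A] [HopfAlgebra ℂ A] [StarRing A] [StarModule ℂ A]
  [Ring H] [HopfAlgebra ℂ H] [StarRing H] [StarModule ℂ H] (Q : HomogeneousSpace A H)

/-- Coassociativity of the right `H`-coaction on `A`. -/
theorem rightCoaction_coassoc (a : A) :
    TensorProduct.assoc ℂ A H H (Q.rightCoaction.toLinearMap.rTensor H (Q.rightCoaction a)) =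
      (Coalgebra.comul (R := ℂ) (A := H)).lTensor A (Q.rightCoaction a) := by
  have hρ : ∀ a, Q.rightCoaction a =
      (Q.π : A →ₐ[ℂ] H).toLinearMap.lTensor A (Coalgebra.comul (R := ℂ) a) := fun a => rfl
  have h1 : ∀ u : A ⊗[ℂ] A, TensorProduct.assoc ℂ A H H (Q.rightCoaction.toLinearMap.rTensor H
      ((Q.π : A →ₐ[ℂ] H).toLinearMap.lTensor A u)) =
      (TensorProduct.map (Q.π : A →ₐ[ℂ] H).toLinearMap (Q.π : A →ₐ[ℂ] H).toLinearMap).lTensor A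
        (TensorProduct.assoc ℂ A A A ((Coalgebra.comul (R := ℂ) (A := A)).rTensor A u)) := by
    intro u
    induction u with
    | zero => simp
    | tmul x y =>
      rw [LinearMap.lTensor_tmul, LinearMap.rTensor_tmul, LinearMap.rTensor_tmul,
        AlgHom.toLinearMap_apply, hρ]
      generalize Coalgebra.comul (R := ℂ) x = v
      induction v with
      | zero => simp
      | tmul z w => simp
      | add z w hz hw => rw [map_add, TensorProduct.add_tmul, map_add, hz, hw,
          TensorProduct.add_tmul, map_add, map_add]
    | add x y hx hy => simp only [map_add, hx, hy]
  have h2 : TensorProduct.map (Q.π : A →ₐ[ℂ] H).toLinearMap (Q.π : A →ₐ[ℂ] H).toLinearMap ∘ₗ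
      Coalgebra.comul (R := ℂ) (A := A) =
      Coalgebra.comul (R := ℂ) (A := H) ∘ₗ (Q.π : A →ₐ[ℂ] H).toLinearMap :=
    CoalgHomClass.map_comp_comul Q.π
  rw [hρ, h1, Coalgebra.coassoc_apply, ← LinearMap.comp_apply, ← LinearMap.lTensor_comp, h2,
    LinearMap.lTensor_comp, LinearMap.comp_apply]

/-- The map `a ↦ a₍₁₎ h_H(π(a₍₂₎))`, with `h_H` the Haar functional of `H`. -/
def condExpAux : A →ₗ[ℂ] A :=
  (TensorProduct.rid ℂ A).toLinearMap ∘ₗ Q.isCQGA_right.haar.lTensor A ∘ₗ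
    Q.rightCoaction.toLinearMap

theorem condExpAux_mem (a : A) : Q.condExpAux a ∈ Q.coinv := by
  rw [mem_coinv]
  have h1 : ∀ t : A ⊗[ℂ] H, Q.rightCoaction
      (TensorProduct.rid ℂ A (Q.isCQGA_right.haar.lTensor A t)) =
      ((TensorProduct.rid ℂ H).toLinearMap ∘ₗ Q.isCQGA_right.haar.lTensor H).lTensor A
        (TensorProduct.assoc ℂ A H H (Q.rightCoaction.toLinearMap.rTensor H t)) := by
    intro t
    induction t with
    | zero => simp
    | tmul x y =>
      rw [LinearMap.lTensor_tmul, TensorProduct.rid_tmul, map_smul, LinearMap.rTensor_tmul,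
        AlgHom.toLinearMap_apply]
      generalize Q.rightCoaction x = u
      induction u with
      | zero => simp
      | tmul z w => simp
      | add z w hz hw => rw [smul_add, hz, hw, TensorProduct.add_tmul, map_add, map_add]
    | add x y hx hy => simp only [map_add, hx, hy]
  have h2 : ∀ t : A ⊗[ℂ] H,
      ((TensorProduct.rid ℂ H).toLinearMap ∘ₗ Q.isCQGA_right.haar.lTensor H).lTensor A
        ((Coalgebra.comul (R := ℂ) (A := H)).lTensor A t) =
      TensorProduct.rid ℂ A (Q.isCQGA_right.haar.lTensor A t) ⊗ₜ[ℂ] (1 : H) := by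
    intro t
    induction t with
    | zero => simp
    | tmul x y =>
      rw [LinearMap.lTensor_tmul, LinearMap.lTensor_tmul, LinearMap.comp_apply,
        LinearEquiv.coe_coe, Q.isCQGA_right.isHaarFunctional_haar.right_inv]
      simp [TensorProduct.smul_tmul]
    | add x y hx hy => simp only [map_add, hx, hy, TensorProduct.add_tmul]
  change Q.rightCoaction (TensorProduct.rid ℂ A (Q.isCQGA_right.haar.lTensor A
    (Q.rightCoaction a))) = _
  rw [h1, Q.rightCoaction_coassoc, h2]
  rfl

/-- The conditional expectation `E : A → B`, `E(a) = a₍₁₎ h_H(π(a₍₂₎))`. -/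
def condExp : A →ₗ[ℂ] Q.coinv :=
  LinearMap.codRestrict (Subalgebra.toSubmodule Q.coinv.toSubalgebra) Q.condExpAux Q.condExpAux_mem

theorem condExp_one : Q.condExp 1 = 1 := by
  apply Subtype.ext
  change TensorProduct.rid ℂ A (Q.isCQGA_right.haar.lTensor A (Q.rightCoaction 1)) = 1
  rw [map_one, Algebra.TensorProduct.one_def, LinearMap.lTensor_tmul,
    Q.isCQGA_right.isHaarFunctional_haar.map_one, TensorProduct.rid_tmul, one_smul]

/-- `E` is right `B`-linear. -/
theorem condExp_mul (a : A) (b : Q.coinv) : Q.condExp (a * b) = Q.condExp a * b := by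
  apply Subtype.ext
  change TensorProduct.rid ℂ A (Q.isCQGA_right.haar.lTensor A (Q.rightCoaction (a * b))) =
    TensorProduct.rid ℂ A (Q.isCQGA_right.haar.lTensor A (Q.rightCoaction a)) * b
  rw [map_mul, Q.mem_coinv.1 b.2]
  generalize Q.rightCoaction a = t
  induction t with
  | zero => simp
  | tmul x y => simp
  | add x y hx hy => simp only [add_mul, map_add, hx, hy]

end HomogeneousSpace

/-! ### Finite multiplicities -/

/-- A family of linear maps `T x : M → Φ` that separates points, and depends only on the image of
the parameter `x` in a finite-dimensional space of operators, embeds `M` into a finite-dimensional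
space. -/
theorem finiteDimensional_of_separating {X W M Φ : Type*} [AddCommGroup X] [Module ℂ X]
    [AddCommGroup W] [Module ℂ W] [FiniteDimensional ℂ W] [AddCommGroup M] [Module ℂ M]
    [AddCommGroup Φ] [Module ℂ Φ] [FiniteDimensional ℂ Φ] (r : X →ₗ[ℂ] W →ₗ[ℂ] W)
    (T : X →ₗ[ℂ] M →ₗ[ℂ] Φ) (hT : ∀ m, (∀ x, T x m = 0) → m = 0)
    (hr : ∀ m x, r x = 0 → T x m = 0) : FiniteDimensional ℂ M := by
  obtain ⟨s, hs⟩ := r.rangeRestrict.exists_rightInverse_of_surjective r.range_rangeRestrict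
  refine FiniteDimensional.of_injective ((LinearMap.lcomp ℂ Φ s) ∘ₗ T.flip) ?_
  rw [← LinearMap.ker_eq_bot, LinearMap.ker_eq_bot']
  intro m hm
  refine hT m fun x => ?_
  have h1 : T (s (r.rangeRestrict x)) m = 0 := LinearMap.congr_fun hm (r.rangeRestrict x)
  have h2 : r (x - s (r.rangeRestrict x)) = 0 := by
    rw [map_sub, sub_eq_zero]
    exact (congrArg Subtype.val (LinearMap.congr_fun hs (r.rangeRestrict x))).symm
  have h3 := hr m _ h2
  rwa [map_sub, LinearMap.sub_apply, h1, sub_zero] at h3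

namespace CovariantCalculus

variable {A H : Type*} [Ring A] [HopfAlgebra ℂ A] [StarRing A] [StarModule ℂ A]
  [Ring H] [HopfAlgebra ℂ H] [StarRing H] [StarModule ℂ H] {Q : HomogeneousSpace A H}
  {Ω : Type*} [Ring Ω] [Algebra ℂ Ω] (C : CovariantCalculus Q Ω)

/-- The subspace `B⁺ Ω` of `Ω`; the fibre at the base point is `Ω / B⁺ Ω`. -/
def fibreKer : Submodule ℂ Ω := C.augmentation * ⊤

theorem incl_sub_counit_mul_mem (b : Q.coinv) (x : Ω) :
    C.incl b * x - Coalgebra.counit (R := ℂ) (b : A) • x ∈ C.fibreKer := by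
  have h : b - algebraMap ℂ Q.coinv (Coalgebra.counit (R := ℂ) (b : A)) ∈
      LinearMap.ker ((Coalgebra.counit (R := ℂ) (A := A)) ∘ₗ Q.inclLin) := by
    rw [LinearMap.mem_ker, LinearMap.comp_apply]
    change Coalgebra.counit (R := ℂ)
      ((b : A) - algebraMap ℂ A (Coalgebra.counit (R := ℂ) (b : A))) = 0
    rw [map_sub, Algebra.algebraMap_eq_smul_one, map_smul, Bialgebra.counit_one, smul_eq_mul,
      mul_one, sub_self]
  have h2 := Submodule.mul_mem_mul (Submodule.mem_map_of_mem (f := C.incl.toLinearMap) h)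
    (Submodule.mem_top (x := x))
  rwa [AlgHom.toLinearMap_apply, map_sub, AlgHom.commutes, sub_mul,
    Algebra.algebraMap_eq_smul_one, smul_mul_assoc, one_mul] at h2

/-- The fibre at the base point of a finitely generated left `B`-module is finite-dimensional. -/
theorem finiteDimensional_fibre (hC : C.IsObject) : FiniteDimensional ℂ (Ω ⧸ C.fibreKer) := by
  classical
  obtain ⟨⟨s, hs⟩, -⟩ := hC
  refine ⟨⟨s.image C.fibreKer.mkQ, ?_⟩⟩
  rw [eq_top_iff]
  rintro x -
  obtain ⟨ω, rfl⟩ := C.fibreKer.mkQ_surjective x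
  obtain ⟨c, hc⟩ := hs ω
  rw [hc, map_sum]
  refine Submodule.sum_mem _ fun y hy => ?_
  rw [sub_eq_zero.1 (((map_sub C.fibreKer.mkQ _ _).symm.trans
    ((Submodule.Quotient.mk_eq_zero _).2 (C.incl_sub_counit_mul_mem (c y) y)))), map_smul]
  exact Submodule.smul_mem _ _ (Submodule.subset_span
    (Finset.mem_coe.2 (Finset.mem_image_of_mem _ hy)))

/-- The map `a ⊗ ω ↦ a S(ω₍₋₁₎) ⊗ ω₍₀₎`. -/
def untwist : A ⊗[ℂ] Ω →ₗ[ℂ] A ⊗[ℂ] Ω :=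
  TensorProduct.lift ((LinearMap.mul ℂ (A ⊗[ℂ] Ω)).compl₁₂
    (Algebra.TensorProduct.includeLeft (R := ℂ) (S := ℂ) (A := A) (B := Ω)).toLinearMap
    ((HopfAlgebra.antipode ℂ).rTensor Ω ∘ₗ C.coact.toLinearMap))

theorem untwist_tmul (a : A) (ω : Ω) : C.untwist (a ⊗ₜ[ℂ] ω) =
    (a ⊗ₜ[ℂ] (1 : Ω)) * (HopfAlgebra.antipode ℂ).rTensor Ω (C.coact ω) := rfl

theorem untwist_coact (ω : Ω) : C.untwist (C.coact ω) = (1 : A) ⊗ₜ[ℂ] ω := by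
  have h1 : ∀ t : A ⊗[ℂ] Ω, C.untwist t =
      (LinearMap.mul' ℂ A ∘ₗ (HopfAlgebra.antipode ℂ).lTensor A).rTensor Ω
        ((TensorProduct.assoc ℂ A A Ω).symm (C.coact.toLinearMap.lTensor A t)) := by
    intro t
    induction t with
    | zero => simp
    | tmul a x =>
      rw [untwist_tmul, LinearMap.lTensor_tmul, AlgHom.toLinearMap_apply]
      generalize C.coact x = u
      induction u with
      | zero => simp
      | tmul b y => simp
      | add x y hx hy => rw [map_add, mul_add, hx, hy, TensorProduct.tmul_add, map_add, map_add]
    | add x y hx hy => rw [map_add, hx, hy, map_add, map_add, map_add]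
  rw [h1, ← C.coassoc, LinearEquiv.symm_apply_apply, ← LinearMap.comp_apply,
    ← LinearMap.rTensor_comp, LinearMap.comp_assoc, HopfAlgebra.mul_antipode_lTensor_comul,
    C.rTensor_counit_coact]

/-- The map `a ⊗ ω ↦ E(a) ω`. -/
def condExpMul : A ⊗[ℂ] Ω →ₗ[ℂ] Ω :=
  LinearMap.mul' ℂ Ω ∘ₗ (C.incl.toLinearMap ∘ₗ Q.condExp).rTensor Ω

theorem condExpMul_tmul (a : A) (ω : Ω) :
    C.condExpMul (a ⊗ₜ[ℂ] ω) = C.incl (Q.condExp a) * ω := by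
  simp [condExpMul]

/-- The composition `a ⊗ ω ↦ E(a S(ω₍₋₁₎)) ω₍₀₎` kills `A ⊗ B⁺ Ω`, since `S(b₍₁₎) b₍₂₎ = ε(b) 1`. -/
theorem condExpMul_untwist_eq_zero (a : A) {ω : Ω} (hω : ω ∈ C.fibreKer) :
    C.condExpMul (C.untwist (a ⊗ₜ[ℂ] ω)) = 0 := by
  induction hω using Submodule.mul_induction_on' with
  | mem_mul_mem m hm x _ =>
    obtain ⟨b, hb, rfl⟩ := hm
    rw [SetLike.mem_coe, LinearMap.mem_ker, LinearMap.comp_apply] at hb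
    rw [untwist_tmul, AlgHom.toLinearMap_apply, map_mul C.coact, C.coact_incl]
    generalize C.coact x = t
    induction t with
    | zero => simp
    | tmul c y =>
      have key : ∀ w : A ⊗[ℂ] Q.coinv, C.condExpMul ((a ⊗ₜ[ℂ] (1 : Ω)) *
          (HopfAlgebra.antipode ℂ).rTensor Ω (C.incl.toLinearMap.lTensor A w * c ⊗ₜ[ℂ] y)) =
          C.incl (Q.condExp (a * HopfAlgebra.antipode ℂ c * LinearMap.mul' ℂ A
            ((HopfAlgebra.antipode ℂ).rTensor A (Q.inclLin.lTensor A w)))) * y := by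
        intro w
        induction w with
        | zero => simp
        | tmul d b =>
          rw [LinearMap.lTensor_tmul, LinearMap.lTensor_tmul, LinearMap.rTensor_tmul,
            LinearMap.mul'_apply, ← mul_assoc]
          rw [show Q.inclLin b = (b : A) from rfl, Q.condExp_mul, map_mul C.incl,
            mul_assoc (C.incl _), ← C.condExpMul_tmul]
          simp [HopfAlgebra.antipode_mul_antidistrib, mul_assoc]
        | add u v hu hv => simp only [map_add, add_mul, mul_add, hu, hv]
      rw [key, Q.lTensor_leftCoaction, HopfAlgebra.mul_antipode_rTensor_comul_apply]
      rw [show Coalgebra.counit (R := ℂ) (b : A) = 0 from hb]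
      simp
    | add u v hu hv => simp only [map_add, mul_add, hu, hv, add_zero]
  | add x _ y _ hx hy => rw [TensorProduct.tmul_add, map_add, map_add, hx, hy, add_zero]

/-- A form all of whose translates vanish at the base point is zero. The inverse of
`ω ↦ ω₍₋₁₎ ⊗ [ω₍₀₎]` on its image is induced by `a ⊗ ω ↦ E(a S(ω₍₋₁₎)) ω₍₀₎`. -/
theorem eq_zero_of_act_mem_fibreKer {ω : Ω} (h : ∀ χ : A →ₗ[ℂ] ℂ, C.act χ ω ∈ C.fibreKer) :
    ω = 0 := by
  have h1 : C.fibreKer.mkQ.lTensor A (C.coact ω) = 0 :=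
    eq_zero_of_slice_eq_zero fun χ => by
      rw [slice_lTensor, ← C.act_apply]
      exact (Submodule.Quotient.mk_eq_zero _).2 (h χ)
  have hex : Function.Exact (C.fibreKer.subtype.lTensor A) (C.fibreKer.mkQ.lTensor A) :=
    lTensor_exact A (LinearMap.exact_subtype_mkQ _) C.fibreKer.mkQ_surjective
  obtain ⟨t, ht⟩ := (hex _).1 h1
  have h2 : C.condExpMul (C.untwist (C.coact ω)) = 0 := by
    rw [← ht]
    clear ht
    induction t with
    | zero => simp
    | tmul a x => exact C.condExpMul_untwist_eq_zero a x.2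
    | add x y hx hy => rw [map_add, map_add, map_add, hx, hy, add_zero]
  rwa [untwist_coact, condExpMul_tmul, Q.condExp_one, map_one, one_mul] at h2

/-- The action as a linear map in the functional. -/
def actHom : (A →ₗ[ℂ] ℂ) →ₗ[ℂ] Ω →ₗ[ℂ] Ω where
  toFun := C.act
  map_add' χ ξ := LinearMap.ext fun ω => by
    simp [act_apply, slice, LinearMap.rTensor_add]
  map_smul' c χ := LinearMap.ext fun ω => by
    simp [act_apply, slice, LinearMap.rTensor_smul]

/-- Finiteness of multiplicities. A form `ω` is determined by the map `χ ↦ [T_χ ω]` into the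
finite-dimensional fibre, and if `T_χ ω` depends only on the restriction of `T_χ` to `W`, then this
is a map on a finite-dimensional space of operators on `W`. -/
theorem finiteDimensional_of_act_eq_zero (hC : C.IsObject) {W V : Submodule ℂ Ω}
    (hfin : FiniteDimensional ℂ W) (hW : ∀ χ : A →ₗ[ℂ] ℂ, ∀ w ∈ W, C.act χ w ∈ W)
    (hV : ∀ ω ∈ V, ∀ χ : A →ₗ[ℂ] ℂ, (∀ w ∈ W, C.act χ w = 0) → C.act χ ω = 0) :
    FiniteDimensional ℂ V := by
  have := C.finiteDimensional_fibre hC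
  let r : (A →ₗ[ℂ] ℂ) →ₗ[ℂ] W →ₗ[ℂ] W :=
    { toFun := fun χ => (C.act χ).restrict (hW χ)
      map_add' := fun χ ξ => LinearMap.ext fun w => Subtype.ext
        (LinearMap.congr_fun (C.actHom.map_add χ ξ) w.1)
      map_smul' := fun c χ => LinearMap.ext fun w => Subtype.ext
        (LinearMap.congr_fun (C.actHom.map_smul c χ) w.1) }
  refine finiteDimensional_of_separating (W := W) (Φ := Ω ⧸ C.fibreKer) r
    (T := (LinearMap.lcomp ℂ _ V.subtype) ∘ₗ (LinearMap.llcomp ℂ _ _ _ C.fibreKer.mkQ) ∘ₗ C.actHom)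
    (fun ω hω => ?_) fun ω χ hχ => ?_
  · exact Subtype.ext (C.eq_zero_of_act_mem_fibreKer fun χ =>
      (Submodule.Quotient.mk_eq_zero _).1 (hω χ))
  · have h := hV ω ω.2 χ fun w hw => congrArg Subtype.val (LinearMap.congr_fun hχ ⟨w, hw⟩)
    change C.fibreKer.mkQ (C.act χ ω) = 0
    rw [h, map_zero]

end CovariantCalculus

/-! ### Dirac and Laplace operators -/

namespace HermitianSpace

variable {A H Ω : Type*} [Ring A] [HopfAlgebra ℂ A] [StarRing A] [StarModule ℂ A]
  [Ring H] [HopfAlgebra ℂ H] [StarRing H] [StarModule ℂ H] [Ring Ω] [Algebra ℂ Ω]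
  (S : HermitianSpace A H Ω)

/-- The operator `T_χ` on the inner product space of forms. -/
def formAct (χ : A →ₗ[ℂ] ℂ) : S.Forms →ₗ[ℂ] S.Forms := S.C.act χ

theorem isUnitaryAction_formAct : IsUnitaryAction (Set.range S.formAct) where
  comp_mem := by
    rintro _ ⟨χ, rfl⟩ _ ⟨ξ, rfl⟩
    exact ⟨_, LinearMap.ext fun ω => (S.C.act_act χ ξ ω).symm⟩
  exists_adjoint := by
    rintro _ ⟨χ, rfl⟩
    refine ⟨_, ⟨dualStar χ, rfl⟩, fun x y => ?_⟩
    change S.pairing y (S.C.act χ x) = S.pairing (S.C.act (dualStar χ) y) x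
    exact (S.pairing_conj (S.C.act χ x) y).symm.trans
      ((congrArg _ (S.pairing_act_left χ x y)).trans (S.pairing_conj _ _))
  locally_finite x := by
    refine ⟨Submodule.span ℂ (Set.range fun χ : A →ₗ[ℂ] ℂ => S.C.act χ x),
      S.C.finite_range_act x, ?_, ?_⟩
    · rintro _ ⟨χ, rfl⟩ y hy
      induction hy using Submodule.span_induction with
      | mem y hy =>
        obtain ⟨ξ, rfl⟩ := hy
        exact Submodule.subset_span ⟨_, (S.C.act_act χ ξ x).symm⟩
      | zero => rw [map_zero]; exact Submodule.zero_mem _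
      | add y z _ _ hy hz => rw [map_add]; exact Submodule.add_mem _ hy hz
      | smul c y _ hy => rw [map_smul]; exact Submodule.smul_mem _ c hy
    · exact Submodule.subset_span ⟨_, S.C.act_counit x⟩
  finite_isotypic W hWfin hW :=
    S.C.finiteDimensional_of_act_eq_zero S.isObject hWfin (fun χ w hw => hW _ ⟨χ, rfl⟩ w hw)
      fun _ hω χ h => hω _ ⟨χ, rfl⟩ h

theorem inCommutant_formAct {f : S.Forms →ₗ[ℂ] S.Forms}
    (hf : f = S.del ∨ f = S.delBar ∨ f = S.d) : InCommutant (Set.range S.formAct) f := by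
  rintro _ ⟨χ, rfl⟩ x
  rcases hf with rfl | rfl | rfl
  · exact S.act_shiftPart (1, 0) χ x
  · exact S.act_shiftPart (0, 1) χ x
  · exact S.act_d χ x

theorem isAdjoint_dagger {f : S.Forms →ₗ[ℂ] S.Forms}
    (hf : InCommutant (Set.range S.formAct) f) : S.IsAdjoint f (S.dagger f) := by
  have h : ∃ g : S.Forms →ₗ[ℂ] S.Forms, S.IsAdjoint f g :=
    S.isUnitaryAction_formAct.exists_adjoint_of_inCommutant hf
  rw [dagger, dif_pos h]
  exact h.choose_spec

theorem dirac_isSymmetric {f : S.Forms →ₗ[ℂ] S.Forms} (hf : S.IsAdjoint f (S.dagger f)) :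
    (S.dirac f).IsSymmetric := by
  intro x y
  have h : ⟪S.dagger f x, y⟫_ℂ = ⟪x, f y⟫_ℂ := by
    rw [← inner_conj_symm, ← hf, inner_conj_symm]
  simp only [dirac, LinearMap.add_apply]
  rw [inner_add_left, inner_add_right, hf, h, add_comm]

theorem dirac_inCommutant {f : S.Forms →ₗ[ℂ] S.Forms}
    (hf : InCommutant (Set.range S.formAct) f) :
    InCommutant (Set.range S.formAct) (S.dirac f) := by
  have h := S.isUnitaryAction_formAct.adjoint_inCommutant hf (S.isAdjoint_dagger hf)
  intro t ht x
  simp only [dirac, LinearMap.add_apply, map_add]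
  rw [hf t ht, h t ht]

end HermitianSpace

end CQH

end

theorem mainTheorem10 {A H Ω : Type*} [Ring A] [HopfAlgebra ℂ A] [StarRing A] [StarModule ℂ A]
    [Ring H] [HopfAlgebra ℂ H] [StarRing H] [StarModule ℂ H] [Ring Ω] [Algebra ℂ Ω]
    (S : CQH.HermitianSpace A H Ω) (f : S.Forms →ₗ[ℂ] S.Forms)
    (hf : f = S.del ∨ f = S.delBar ∨ f = S.d) :
    S.IsAdjoint f (S.dagger f) ∧
      CQH.IsDiagonalisable (S.toL2 (S.dirac f)) ∧
      CQH.IsEssentiallySelfAdjoint (S.toL2 (S.dirac f)) ∧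
      CQH.IsDiagonalisable (S.toL2 (S.laplace f)) ∧
      CQH.IsEssentiallySelfAdjoint (S.toL2 (S.laplace f)) := by
  have hcomm := S.inCommutant_formAct hf
  have hadj := S.isAdjoint_dagger hcomm
  have hsymm := S.dirac_isSymmetric hadj
  obtain ⟨w, hw, hspan, heig⟩ := S.isUnitaryAction_formAct.exists_orthonormal_eigenvectors
    (S.dirac_inCommutant hcomm) hsymm
  have hD := S.diagonalisable_and_essentiallySelfAdjoint hsymm hw hspan heig
  have hsymm' : (S.laplace f).IsSymmetric := fun x y => by
    rw [CQH.HermitianSpace.laplace, LinearMap.comp_apply, hsymm, hsymm, LinearMap.comp_apply]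
  have hΔ := S.diagonalisable_and_essentiallySelfAdjoint hsymm' hw hspan fun x hx => by
    obtain ⟨c, hc⟩ := heig x hx
    refine ⟨c * c, ?_⟩
    rw [CQH.HermitianSpace.laplace, LinearMap.comp_apply, hc, map_smul, hc, smul_smul,
      Complex.ofReal_mul]
  exact ⟨hadj, hD.1, hD.2, hΔ.1, hΔ.2⟩
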